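/- A non-deterministic timed automaton with silent transitions (eNTA) $A$ consists of a finite set $Q$ of locations with an initial location $q_0\in Q$ and a set $F\subseteq Q$ of accepting locations ($F=Q$ is allowed), a finite set $\Sigma$ of observable actions and a silent label $\epsilon\notin\Sigma$, a finite set $C$ of clocks, and a finite set of transitions $(q,a,g,R,q')$ with $q,q'\in Q$, $a\in\Sigma\cup\{\epsilon\}$, $R\subseteq C$ the set of clocks to be reset, and $g$ a finite conjunction of constraints $c\sim n$ with $c\in C$, ${\sim}\in\{<,\le,=,\ge,>\}$, $n\in\{0,1,2,\dots\}$. A finite run starts in $q_0$ with all clocks equal to $0$ and alternates delays $d_i\in\mathbb{R}_{\ge 0}$, which increase all clocks by $d_i$, with transitions $(q,a_i,g,R,q')$ taken from the current location $q$ when $g$ holds; taking one resets the clocks in $R$ to $0$ and moves to $q'$. Its observable timed trace is obtained from $(t_1,a_1),\dots,(t_k,a_k)$, $t_i=d_1+\dots+d_i$, by deleting the pairs with $a_i=\epsilon$. The language $\mathfrak{L}(A)$ is the set of observable timed traces of the finite runs of $A$ that end in an accepting location. **Proposition.** The $1$-bounded universality problem for eNTA is decidable: there is an algorithm which, given (a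 finite description of) any eNTA $A$, decides whether $\mathfrak{L}(A)$ contains every timed trace over $\Sigma$ of length at most $1$, that is, the empty trace and all traces $(t,a)$ with $t\in\mathbb{R}_{\ge 0}$ and $a\in\Sigma$. -/

import Mathlib

open scoped NNReal

/-- The comparison symbols `<, ≤, =, ≥, >` of clock constraints. -/
inductive Cmp where
  | lt
  | le
  | eq
  | ge
  | gt

/-- The meaning of a comparison symbol on `ℝ≥0`. -/
def Cmp.Holds : Cmp → ℝ≥0 → ℝ≥0 → Prop
  | .lt, x, y => x < y
  | .le, x, y => x ≤ y
  | .eq, x, y => x = y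
  | .ge, x, y => x ≥ y
  | .gt, x, y => x > y

/-- An atomic constraint `c ∼ n` with a clock `c` and a constant `n ∈ {0, 1, 2, …}`. -/
structure ClockConstraint (C : Type) where
  clock : C
  cmp : Cmp
  bound : ℕ

/-- A transition `(q, a, g, R, q')`.  The label `none` is the silent label `ε`; the guard is the
conjunction of the listed constraints; `resets` lists the clocks to be reset. -/
structure Transition (Q Act C : Type) where
  source : Q
  label : Option Act
  guard : List (ClockConstraint C)
  resets : List C
  target : Q

/-- A non-deterministic timed automaton with silent transitions, with locations `Q`, observable
actions `Act` and clocks `C` (finite types in all uses).  Finite sets of transitions and of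
accepting locations are presented as lists, whose order and repetitions play no role. -/
structure ENTA (Q Act C : Type) where
  init : Q
  accepting : List Q
  transitions : List (Transition Q Act C)

/-- Clock valuations. -/
abbrev ClockValuation (C : Type) := C → ℝ≥0

namespace ClockValuation

variable {C : Type}

/-- `v + d`: all clocks advance by `d`. -/
def delay (v : ClockValuation C) (d : ℝ≥0) : ClockValuation C := fun c => v c + d

open Classical in
/-- `v[R]`: the clocks in `R` are set to `0`, the others keep their values. -/
noncomputable def reset (v : ClockValuation C) (R : List C) : ClockValuation C :=
  fun c => if c ∈ R then 0 else v c

/-- `v ⊨ g`: all constraints of the conjunction `g` hold at `v`. -/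
def Satisfies (v : ClockValuation C) (g : List (ClockConstraint C)) : Prop :=
  ∀ φ ∈ g, φ.cmp.Holds (v φ.clock) (φ.bound : ℝ≥0)

end ClockValuation

/-- Timed traces over a set of labels `α`, as lists of pairs (absolute time, label). -/
abbrev Trace (α : Type) := List (ℝ≥0 × α)

/-- The possible timed traces: the times, counted from the start, never decrease. -/
def Trace.IsTimed {α : Type} (w : Trace α) : Prop :=
  w.Pairwise fun x y => x.1 ≤ y.1

/-- The observable timed trace: the pairs with silent label are deleted. -/
def Trace.observable {Act : Type} (l : Trace (Option Act)) : Trace Act :=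
  l.filterMap fun x => x.2.map fun a => (x.1, a)

namespace ENTA

variable {Q Act C : Type}

/-- States of the timed transition system. -/
abbrev State (Q C : Type) := Q × ClockValuation C

/-- Timed transition `(q, v) → (q, v + d)`. -/
def Delay (d : ℝ≥0) (s s' : State Q C) : Prop :=
  s'.1 = s.1 ∧ s'.2 = s.2.delay d

/-- Discrete transition `(q, v) → (q', v[R])` along `τ`, a transition of `A` enabled at `(q, v)`. -/
def Jump (A : ENTA Q Act C) (τ : Transition Q Act C) (s s' : State Q C) : Prop :=
  τ ∈ A.transitions ∧ τ.source = s.1 ∧ s.2.Satisfies τ.guard ∧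
    s'.1 = τ.target ∧ s'.2 = s.2.reset τ.resets

/-- `A.Run s t l`: there is a finite run of `A` (delays and jumps alternating, from the initial
location with all clocks `0`) that ends in the state `s`, has duration `t`, and induces the timed
trace `l`. -/
inductive Run (A : ENTA Q Act C) : State Q C → ℝ≥0 → Trace (Option Act) → Prop
  | start : Run A (A.init, fun _ => 0) 0 []
  | step {s s₁ s₂ : State Q C} {t : ℝ≥0} {l : Trace (Option Act)} (d : ℝ≥0)
      (τ : Transition Q Act C) (hrun : Run A s t l) (hdelay : Delay d s s₁)
      (hjump : A.Jump τ s₁ s₂) : Run A s₂ (t + d) (l ++ [(t + d, τ.label)])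

/-- The language of `A`: the observable timed traces of the runs of `A` that end in an accepting
location. -/
def language (A : ENTA Q Act C) : Set (Trace Act) :=
  {w | ∃ s t l, A.Run s t l ∧ s.1 ∈ A.accepting ∧ l.observable = w}

/-- The members of the language of length at most `k`. -/
def boundedLanguage (A : ENTA Q Act C) (k : ℕ) : Set (Trace Act) :=
  {w | w ∈ A.language ∧ w.length ≤ k}

/-- `k`-bounded universality: all timed traces over the observable actions of length at most `k`
are in the language. -/
def BoundedUniversal (A : ENTA Q Act C) (k : ℕ) : Prop :=
  ∀ w : Trace Act, w.IsTimed → w.length ≤ k → w ∈ A.boundedLanguage k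

end ENTA

/-! ### Presentation of automata as finite data, the inputs of algorithms -/

/-- A number for each comparison symbol. -/
def Cmp.code : Cmp → ℕ
  | .lt => 0
  | .le => 1
  | .eq => 2
  | .ge => 3
  | .gt => 4

/-- Codes of transitions: source, label, guard, resets, target. -/
abbrev TransitionCode := ℕ × Option ℕ × List (ℕ × ℕ × ℕ) × List ℕ × ℕ

/-- Codes of automata: the numbers of locations, actions and clocks, the initial location, the
accepting locations, the transitions.  All of these are Mathlib's lists, pairs and options of
natural numbers, with Mathlib's encodings. -/
abbrev ENTACode := (ℕ × ℕ × ℕ) × ℕ × List ℕ × List TransitionCode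

/-- The code of a transition, given numberings of the locations, actions and clocks. -/
def Transition.code {Q Act C : Type} {n m r : ℕ} (eQ : Q ≃ Fin n) (eA : Act ≃ Fin m)
    (eC : C ≃ Fin r) (τ : Transition Q Act C) : TransitionCode :=
  ((eQ τ.source : ℕ),
    τ.label.map (fun a => (eA a : ℕ)),
    τ.guard.map (fun φ => ((eC φ.clock : ℕ), φ.cmp.code, φ.bound)),
    τ.resets.map (fun c => (eC c : ℕ)),
    (eQ τ.target : ℕ))

/-- The code of an automaton, given numberings of its locations, actions and clocks. -/
def ENTA.code {Q Act C : Type} {n m r : ℕ} (eQ : Q ≃ Fin n) (eA : Act ≃ Fin m)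
    (eC : C ≃ Fin r) (A : ENTA Q Act C) : ENTACode :=
  ((n, m, r), (eQ A.init : ℕ),
    A.accepting.map (fun q => (eQ q : ℕ)),
    A.transitions.map (Transition.code eQ eA eC))

/-! The automaton gets one extra clock, a timer that it neither reads nor resets. Regions over all
clocks and the timer form a finite quotient, and states in the same region can match each other's
delays and jumps.

The infinitely many times `t` reduce to finitely many checks in two stages. First, membership of
`(t, a)` depends only on the cell of `t`, an integer point `k` or an open interval `(k, k + 1)`: if
the timer starts at `x = k + 1 - t`, emission at time `t` is emission at timer value `k + 1`, and
all starts with `0 < x < 1` and the other clocks at `0` lie in one region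
(`singleton_mem_language_of_inCell`). Secondly, the set of classes reachable silently at time `k`,
with the timer set back to `0`, decides whether the cells at `k` are observed, and it arises by
iterating one fixed map on a finite power set (`classesAt_succ`). Hence the `k` below the number of
such sets represent all others (`cellObserved_forall_of_lt`).

For each remaining `k` the regions are refined to a constant at least `k + 1`. Reachability between
classes needs at most as many moves as there are classes, and a move can be matched by a delay of
bounded size that at most halves the dyadic grid of the clock values (`RegionEq.exists_delay`). So a
finite search over integer clock values, in units of a fixed power of `1 / 2`, settles every cell
(`cellObserved_iff_grid`), and this search is primitive recursive.

Two region constants are needed: the time bound must come from a constant independent of `k`, and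
only then can a constant exceeding all examined times be chosen. -/

/-! ### Paths in finite graphs -/

/-- `ReachIn E n a b`: there is an `E`-path of length `n` from `a` to `b`. -/
def ReachIn {α : Type*} (E : α → α → Prop) : ℕ → α → α → Prop
  | 0, a, b => a = b
  | n + 1, a, b => ∃ c, ReachIn E n a c ∧ E c b

theorem ReachIn.reflTransGen {α : Type*} {E : α → α → Prop} {n : ℕ} {a b : α}
    (h : ReachIn E n a b) : Relation.ReflTransGen E a b := by
  induction n generalizing b with
  | zero => cases h; exact .refl
  | succ n ih => obtain ⟨c, hc, hcb⟩ := h; exact (ih hc).tail hcb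

/-- In a finite reflexive graph, every reachable vertex is reached by a path whose length is the
number of vertices. -/
theorem reachIn_card_of_reflTransGen {α : Type*} [Finite α] {E : α → α → Prop}
    (hE : ∀ a, E a a) {a b : α} (h : Relation.ReflTransGen E a b) :
    ReachIn E (Nat.card α) a b := by
  -- The balls around `a` increase because of the loops, are constant from the first repetition on,
  -- and gain a vertex at every step before it.
  set S : ℕ → Set α := fun n => {b | ReachIn E n a b} with hS
  have hsub : ∀ n, S n ⊆ S (n + 1) := fun n b hb => ⟨b, hb, hE b⟩
  have hmono : Monotone S := monotone_nat_of_le_succ hsub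
  have hstep : ∀ m n, S m = S n → S (m + 1) = S (n + 1) := by
    intro m n hmn
    ext x
    have hc : ∀ c, ReachIn E m a c ↔ ReachIn E n a c := fun c => Set.ext_iff.1 hmn c
    simp only [hS, Set.mem_ofPred_eq, ReachIn, hc]
  have hstab : ∀ m, S m = S (m + 1) → ∀ k, S (m + k) = S m := by
    intro m hm k
    induction k with
    | zero => rfl
    | succ k ih => rw [← add_assoc, hstep _ _ ih, ← hm]
  have hgrow : ∀ n, (∃ m, m < n ∧ S m = S (m + 1)) ∨ n + 1 ≤ (S n).ncard := by
    intro n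
    induction n with
    | zero =>
      right
      exact (Set.ncard_pos (Set.toFinite _)).2 ⟨a, rfl⟩
    | succ n ih =>
      rcases ih with ⟨m, hm, he⟩ | ih
      · exact .inl ⟨m, by omega, he⟩
      · by_cases he : S n = S (n + 1)
        · exact .inl ⟨n, by omega, he⟩
        · right
          have := Set.ncard_lt_ncard ((hsub n).ssubset_of_ne he) (Set.toFinite _)
          omega
  obtain ⟨m, hm, he⟩ : ∃ m, m < Nat.card α ∧ S m = S (m + 1) := by
    rcases hgrow (Nat.card α) with h | h
    · exact h
    · have := Set.ncard_le_card (S (Nat.card α))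
      omega
  have hall : ∀ n, S n ⊆ S (Nat.card α) := by
    intro n
    have h1 : S (Nat.card α) = S m := by
      obtain ⟨k, hk⟩ := Nat.exists_eq_add_of_le hm.le
      rw [hk, hstab m he]
    rw [h1, ← hstab m he n]
    exact hmono (by omega)
  suffices ∃ n, b ∈ S n by
    obtain ⟨n, hn⟩ := this
    exact hall n hn
  clear hall
  induction h with
  | refl => exact ⟨0, rfl⟩
  | tail _ hbc ih =>
    obtain ⟨n, hn⟩ := ih
    exact ⟨n + 1, _, hn, hbc⟩

/-! ### Regions -/

/-- If `p` and `p'` are finite families of reals in the same order, every point not below all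
members of `p` has a counterpart that lies relative to `p'` as the point lies relative to `p`. -/
theorem exists_matching_point {ι : Type*} [Finite ι] (p p' : ι → ℝ)
    (h : ∀ i j, p i ≤ p j ↔ p' i ≤ p' j) (i₀ : ι) {d : ℝ} (hd : p i₀ ≤ d) :
    ∃ d', (∀ i, p i ≤ d ↔ p' i ≤ d') ∧ (∀ i, d ≤ p i ↔ d' ≤ p' i) ∧
      ∃ i, d' = p' i + 1 ∨ ∃ j, d' = (p' i + p' j) / 2 := by
  obtain ⟨i, hi, hmax⟩ := Set.exists_max_image {i | p i ≤ d} p (Set.toFinite _) ⟨i₀, hd⟩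
  simp only [Set.mem_ofPred_eq] at hi hmax
  -- With `p i` the largest point not above `d`, there are three cases: `d` hits `p i`, lies
  -- strictly between two consecutive points, or lies beyond all points. The counterparts are `p'
  -- i`, a midpoint, and `p' i + 1`; this explicit form later controls size and grid.
  rcases hi.eq_or_lt with rfl | hi
  · exact ⟨p' i, fun j => h j i, fun j => h i j, i, .inr ⟨i, by ring⟩⟩
  have hlow : ∀ j, p j ≤ d → p' j ≤ p' i := fun j hj => (h j i).1 (hmax j hj)
  by_cases hup : ∃ j, d < p j
  · obtain ⟨j₀, hj₀⟩ := hup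
    obtain ⟨j, hj, hmin⟩ := Set.exists_min_image {i | d < p i} p (Set.toFinite _) ⟨j₀, hj₀⟩
    simp only [Set.mem_ofPred_eq] at hj hmin
    have hij : p' i < p' j := by
      rw [← not_le, ← h]; linarith
    have hhigh : ∀ k, d < p k → p' j ≤ p' k := fun k hk => (h j k).1 (hmin k hk)
    refine ⟨(p' i + p' j) / 2, fun k => ⟨fun hk => ?_, fun hk => ?_⟩,
      fun k => ⟨fun hk => ?_, fun hk => ?_⟩, i, .inr ⟨j, rfl⟩⟩
    · linarith [hlow k hk]
    · by_contra hc; linarith [hhigh k (not_le.1 hc)]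
    · rcases hk.eq_or_lt with rfl | hk
      · linarith [hmax k le_rfl]
      · linarith [hhigh k hk]
    · by_contra hc; linarith [hlow k (not_le.1 hc).le]
  · simp only [not_exists, not_lt] at hup
    refine ⟨p' i + 1, fun k => ⟨fun hk => ?_, fun _ => hup k⟩,
      fun k => ⟨fun hk => ?_, fun hk => ?_⟩, i, .inl rfl⟩
    · linarith [hlow k hk]
    · linarith [hmax k (hup k)]
    · linarith [hlow k (hup k)]

/-- Region equivalence with maximal constant `K`. -/
structure RegionEq {X : Type} (K : ℕ) (v w : ClockValuation X) : Prop where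
  le : ∀ x, ∀ n ≤ K, (v x ≤ (n : ℝ≥0) ↔ w x ≤ n)
  ge : ∀ x, ∀ n ≤ K, ((n : ℝ≥0) ≤ v x ↔ (n : ℝ≥0) ≤ w x)
  -- Comparing differences with integers replaces the usual order of fractional parts. Only clocks
  -- not beyond `K` take part, and their differences are at most `K`, so the constants up to `K`
  -- suffice.
  diff_le : ∀ x y, v x ≤ K → v y ≤ K → ∀ n ≤ K, (v x ≤ v y + (n : ℝ≥0) ↔ w x ≤ w y + n)
  diff_ge : ∀ x y, v x ≤ K → v y ≤ K → ∀ n ≤ K, (v x + (n : ℝ≥0) ≤ v y ↔ w x + n ≤ w y)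

namespace RegionEq

variable {X : Type} {K : ℕ} {v w : ClockValuation X}

theorem le_bound (h : RegionEq K v w) (x : X) : v x ≤ K ↔ w x ≤ K := h.le x K le_rfl

theorem add_le_add_iff (h : RegionEq K v w) {x y : X} (hx : v x ≤ K) (hy : v y ≤ K) {n m : ℕ}
    (hn : n ≤ K) (hm : m ≤ K) :
    (n : ℝ≥0) + v y ≤ m + v x ↔ (n : ℝ≥0) + w y ≤ m + w x := by
  rcases le_total n m with hnm | hnm
  · obtain ⟨k, rfl⟩ := Nat.exists_eq_add_of_le hnm
    have := h.diff_le y x hy hx k (by omega)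
    rw [add_comm (v x), add_comm (w x)] at this
    push_cast
    rw [add_assoc, add_assoc]
    simpa only [add_le_add_iff_left] using this
  · obtain ⟨k, rfl⟩ := Nat.exists_eq_add_of_le hnm
    have := h.diff_ge y x hy hx k (by omega)
    rw [add_comm (v y), add_comm (w y)] at this
    push_cast
    rw [add_assoc, add_assoc]
    simpa only [add_le_add_iff_left] using this

theorem cmp_holds (h : RegionEq K v w) (x : X) {n : ℕ} (hn : n ≤ K) (r : Cmp) :
    r.Holds (v x) n ↔ r.Holds (w x) n := by
  have h1 := h.le x n hn
  have h2 := h.ge x n hn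
  cases r <;> simp only [Cmp.Holds, ge_iff_le, gt_iff_lt]
  · rw [← not_le, ← not_le, h2]
  · exact h1
  · rw [le_antisymm_iff, le_antisymm_iff, h1, h2]
  · exact h2
  · rw [← not_le, ← not_le, h1]

theorem reset (h : RegionEq K v w) (R : List X) : RegionEq K (v.reset R) (w.reset R) where
  le x n hn := by
    by_cases hx : x ∈ R <;> simp [ClockValuation.reset, hx, h.le x n hn]
  ge x n hn := by
    by_cases hx : x ∈ R <;> simp [ClockValuation.reset, hx, h.ge x n hn]
  diff_le x y hx hy n hn := by
    by_cases hxR : x ∈ R <;> by_cases hyR : y ∈ R <;>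
      simp only [ClockValuation.reset, hxR, hyR, if_true, if_false, zero_le, zero_add] at hx hy ⊢
    · exact h.le x n hn
    · exact h.diff_le x y hx hy n hn
  diff_ge x y hx hy n hn := by
    by_cases hxR : x ∈ R <;> by_cases hyR : y ∈ R <;>
      simp only [ClockValuation.reset, hxR, hyR, if_true, if_false, zero_add] at hx hy ⊢
    · exact h.ge y n hn
    -- Only `y` is reset, so the inequality says that `v x` and `n` both vanish; the constant `0` in
    -- `le` detects the former.
    · have := h.le x 0 (by omega)
      simp only [Nat.cast_zero, nonpos_iff_eq_zero] at this
      simp [this]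
    · exact h.diff_ge x y hx hy n hn

end RegionEq

/-- The multiples of `2⁻ⁱ`. -/
def OnGrid (i : ℕ) (x : ℝ≥0) : Prop := ∃ n : ℕ, x * 2 ^ i = n

theorem OnGrid.zero (i : ℕ) : OnGrid i 0 := ⟨0, by simp⟩

theorem OnGrid.add {i : ℕ} {x y : ℝ≥0} : OnGrid i x → OnGrid i y → OnGrid i (x + y) := by
  rintro ⟨n, hn⟩ ⟨m, hm⟩
  exact ⟨n + m, by rw [add_mul, hn, hm]; push_cast; rfl⟩

theorem OnGrid.mono {i j : ℕ} (hij : i ≤ j) {x : ℝ≥0} : OnGrid i x → OnGrid j x := by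
  rintro ⟨n, hn⟩
  obtain ⟨k, rfl⟩ := Nat.exists_eq_add_of_le hij
  exact ⟨n * 2 ^ k, by rw [pow_add, ← mul_assoc, hn]; push_cast; rfl⟩

/-- The delays allowed in the exploration with constant `K` and grid `2⁻ⁱ`. -/
def GridDelay (K i : ℕ) (d : ℝ≥0) : Prop := d ≤ K + 1 ∧ OnGrid i d

/-- The effect of a delay on the region is determined by its position among the critical delays `n -
v x`, at which a clock reaches an integer. The region fixes their order, so `exists_matching_point`
supplies a delay for `w`. Being a critical delay, a midpoint of two, or one more than one, it costs
at most one halving of the grid. -/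
theorem RegionEq.exists_delay {X : Type} [Finite X] {K : ℕ} {v w : ClockValuation X}
    (h : RegionEq K v w) (d : ℝ≥0) :
    ∃ d' : ℝ≥0, d' ≤ K + 1 ∧ (∀ i, (∀ x, OnGrid i (w x)) → OnGrid (i + 1) d') ∧
      RegionEq K (v.delay d) (w.delay d') := by
  classical
  -- The index `none` is the delay `0`, which forces `d'` to be nonnegative. Clocks already beyond
  -- `K` have no critical delays, so their points are placed at `0` too. Both families test `v`,
  -- which agrees with testing `w`.
  set p : Option (X × Fin (K + 1)) → ℝ := fun o =>
    o.elim 0 fun a => if v a.1 ≤ K then (a.2 : ℝ) - v a.1 else 0 with hp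
  set p' : Option (X × Fin (K + 1)) → ℝ := fun o =>
    o.elim 0 fun a => if v a.1 ≤ K then (a.2 : ℝ) - w a.1 else 0 with hp'
  have hnonpos : ∀ (u : ClockValuation X) (x : X) (n : ℕ),
      (n : ℝ) - u x ≤ 0 ↔ (n : ℝ≥0) ≤ u x := by
    intro u x n
    rw [sub_nonpos]; norm_cast
  have hnonneg : ∀ (u : ClockValuation X) (x : X) (n : ℕ),
      0 ≤ (n : ℝ) - u x ↔ u x ≤ (n : ℝ≥0) := by
    intro u x n
    rw [sub_nonneg]; norm_cast
  have hpair : ∀ (u : ClockValuation X) (x y : X) (n m : ℕ),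
      (n : ℝ) - u x ≤ m - u y ↔ (n : ℝ≥0) + u y ≤ m + u x := by
    intro u x y n m
    rw [sub_le_iff_le_add, sub_add_eq_add_sub, le_sub_iff_add_le]; norm_cast
  have hord : ∀ i j, p i ≤ p j ↔ p' i ≤ p' j := by
    rintro (_ | ⟨x, n⟩) (_ | ⟨y, m⟩) <;> simp only [hp, hp', Option.elim]
    · split_ifs with hy
      · rw [hnonneg, hnonneg]; exact h.le y m (by omega)
      · rfl
    · split_ifs with hx
      · rw [hnonpos, hnonpos]; exact h.ge x n (by omega)
      · rfl
    · split_ifs with hx hy hy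
      · rw [hpair, hpair]; exact h.add_le_add_iff hx hy (by omega) (by omega)
      · rw [hnonpos, hnonpos]; exact h.ge x n (by omega)
      · rw [hnonneg, hnonneg]; exact h.le y m (by omega)
      · rfl
  obtain ⟨d', h1, h2, h3⟩ := exists_matching_point p p' hord none (d := d) d.2
  have hd' : 0 ≤ d' := (h1 none).1 d.2
  lift d' to ℝ≥0 using hd'
  have hp'le : ∀ i, p' i ≤ K := by
    rintro (_ | ⟨x, n⟩) <;> simp only [hp', Option.elim]
    · positivity
    · split_ifs
      · have : ((n : ℕ) : ℝ) ≤ K := by exact_mod_cast Nat.lt_succ_iff.1 n.2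
        have := (w x).2
        simp only [NNReal.val_eq_coe] at this
        linarith
      · positivity
  have hgrid : ∀ i, (∀ x, OnGrid i (w x)) → ∀ j, ∃ z : ℤ, p' j * 2 ^ i = z := by
    intro i hi
    rintro (_ | ⟨x, n⟩) <;> simp only [hp', Option.elim]
    · exact ⟨0, by simp⟩
    · split_ifs
      · obtain ⟨k, hk⟩ := hi x
        refine ⟨n * 2 ^ i - k, ?_⟩
        have hk' : (w x : ℝ) * 2 ^ i = k := by exact_mod_cast congrArg NNReal.toReal hk
        rw [sub_mul, hk']; push_cast; rfl
      · exact ⟨0, by simp⟩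
  have hle : ∀ x, v x ≤ K → ∀ n ≤ K, (v x + d ≤ (n : ℝ≥0) ↔ w x + d' ≤ n) := by
    intro x hx n hn
    have := h2 (some (x, ⟨n, by omega⟩))
    simp only [hp, hp', Option.elim, if_pos hx, le_sub_iff_add_le] at this
    rw [add_comm (v x), add_comm (w x)]
    exact_mod_cast this
  have hge : ∀ x, v x ≤ K → ∀ n ≤ K, ((n : ℝ≥0) ≤ v x + d ↔ (n : ℝ≥0) ≤ w x + d') := by
    intro x hx n hn
    have := h1 (some (x, ⟨n, by omega⟩))
    simp only [hp, hp', Option.elim, if_pos hx, sub_le_iff_le_add] at this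
    rw [add_comm (v x), add_comm (w x)]
    exact_mod_cast this
  refine ⟨d', ?_, ?_, ?_⟩
  · have : (d' : ℝ) ≤ K + 1 := by
      obtain ⟨i, hi | ⟨j, hi⟩⟩ := h3
      · linarith [hp'le i]
      · linarith [hp'le i, hp'le j]
    exact_mod_cast this
  · intro i hi
    have hz : ∃ z : ℤ, (d' : ℝ) * 2 ^ (i + 1) = z := by
      obtain ⟨j, hj | ⟨k, hj⟩⟩ := h3
      · obtain ⟨z, hz⟩ := hgrid i hi j
        refine ⟨2 * (z + 2 ^ i), ?_⟩
        rw [hj]; push_cast; rw [← hz]; ring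
      · obtain ⟨z, hz⟩ := hgrid i hi j
        obtain ⟨z', hz'⟩ := hgrid i hi k
        refine ⟨z + z', ?_⟩
        rw [hj]; push_cast; rw [← hz, ← hz']; ring
    obtain ⟨z, hz⟩ := hz
    have hz0 : 0 ≤ z := by
      have : (0 : ℝ) ≤ z := by rw [← hz]; positivity
      exact_mod_cast this
    lift z to ℕ using hz0
    exact ⟨z, NNReal.eq (by push_cast; simpa using hz)⟩
  · have big : ∀ (a b : ℝ≥0) (n : ℕ), n ≤ K → ¬ a ≤ K → ¬ a + b ≤ n := by
      intro a b n hn ha hab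
      exact ha ((le_self_add.trans hab).trans (by exact_mod_cast hn))
    have big' : ∀ (a b : ℝ≥0) (n : ℕ), n ≤ K → ¬ a ≤ K → (n : ℝ≥0) ≤ a + b := by
      intro a b n hn ha
      exact (lt_of_not_ge (big a b n hn ha)).le
    -- Differences are unchanged by delays, and a clock within `K` after the delay was within `K`
    -- before, so the old difference conditions carry over.
    have act : ∀ x, v x + d ≤ (K : ℝ≥0) → v x ≤ K := fun x hx => le_self_add.trans hx
    constructor
    · intro x n hn
      by_cases hx : v x ≤ K
      · exact hle x hx n hn
      · exact iff_of_false (big _ _ n hn hx) (big _ _ n hn fun hw => hx ((h.le_bound x).2 hw))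
    · intro x n hn
      by_cases hx : v x ≤ K
      · exact hge x hx n hn
      · exact iff_of_true (big' _ _ n hn hx) (big' _ _ n hn fun hw => hx ((h.le_bound x).2 hw))
    · intro x y hx hy n hn
      simp only [ClockValuation.delay] at hx hy ⊢
      rw [add_right_comm, add_le_add_iff_right, add_right_comm, add_le_add_iff_right]
      exact h.diff_le x y (act x hx) (act y hy) n hn
    · intro x y hx hy n hn
      simp only [ClockValuation.delay] at hx hy ⊢
      rw [add_right_comm, add_le_add_iff_right, add_right_comm, add_le_add_iff_right]
      exact h.diff_ge x y (act x hx) (act y hy) n hn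

/-- The atomic facts that make up a region. -/
abbrev RegionAtom (X : Type) (K : ℕ) : Type :=
  (X × Fin (K + 1) × Bool) ⊕ (X × X × Fin (K + 1) × Bool)

/-- The region of a valuation, as the set of the atomic facts that hold. -/
def region {X : Type} (K : ℕ) (v : ClockValuation X) : Set (RegionAtom X K) :=
  {a | match a with
    | .inl (x, n, true) => v x ≤ (n : ℕ)
    | .inl (x, n, false) => ((n : ℕ) : ℝ≥0) ≤ v x
    | .inr (x, y, n, true) => v x ≤ K ∧ v y ≤ K ∧ v x ≤ v y + (n : ℕ)
    | .inr (x, y, n, false) => v x ≤ K ∧ v y ≤ K ∧ v x + (n : ℕ) ≤ v y}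

/-- The atoms for differences include the condition that both clocks are within `K`. The one-clock
atoms at `n = K` already settle this condition, so it cancels on both sides. Encoding regions as
subsets of a finite type makes them finite in number, with an explicit bound. -/
theorem region_eq_iff {X : Type} {K : ℕ} {v w : ClockValuation X} :
    region K v = region K w ↔ RegionEq K v w := by
  constructor
  · intro h
    rw [Set.ext_iff] at h
    have hle : ∀ x, ∀ n ≤ K, (v x ≤ (n : ℝ≥0) ↔ w x ≤ n) :=
      fun x n hn => h (.inl (x, ⟨n, by omega⟩, true))
    refine ⟨hle, fun x n hn => h (.inl (x, ⟨n, by omega⟩, false)), ?_, ?_⟩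
    · intro x y hx hy n hn
      have := h (.inr (x, y, ⟨n, by omega⟩, true))
      simpa only [region, Set.mem_ofPred_eq, hx, hy, (hle x K le_rfl).1 hx, (hle y K le_rfl).1 hy,
        true_and] using this
    · intro x y hx hy n hn
      have := h (.inr (x, y, ⟨n, by omega⟩, false))
      simpa only [region, Set.mem_ofPred_eq, hx, hy, (hle x K le_rfl).1 hx, (hle y K le_rfl).1 hy,
        true_and] using this
  · intro h
    ext a
    rcases a with ⟨x, n, _ | _⟩ | ⟨x, y, n, _ | _⟩
    · exact h.ge x n (by omega)
    · exact h.le x n (by omega)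
    · simp only [region, Set.mem_ofPred_eq]
      rw [← h.le_bound x, ← h.le_bound y]
      exact and_congr_right fun hx => and_congr_right fun hy => h.diff_ge x y hx hy n (by omega)
    · simp only [region, Set.mem_ofPred_eq]
      rw [← h.le_bound x, ← h.le_bound y]
      exact and_congr_right fun hx => and_congr_right fun hy => h.diff_le x y hx hy n (by omega)

/-! ### Monotonicity of paths, repetition of iterates, number of subsets -/

theorem ReachIn.mono {α : Type*} {E E' : α → α → Prop} (hE : ∀ a b, E a b → E' a b) {n : ℕ}
    {a b : α} (h : ReachIn E n a b) : ReachIn E' n a b := by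
  induction n generalizing b with
  | zero => exact h
  | succ n ih => obtain ⟨c, hc, hcb⟩ := h; exact ⟨c, ih hc, hE _ _ hcb⟩

theorem exists_iterate_eq_of_lt_card {α : Type*} [Finite α] (f : α → α) (x : α) (n : ℕ) :
    ∃ m < Nat.card α, f^[m] x = f^[n] x := by
  induction n using Nat.strong_induction_on with
  | _ n ih =>
    by_cases hn : n < Nat.card α
    · exact ⟨n, hn, rfl⟩
    have := Fintype.ofFinite α
    obtain ⟨i, j, hij, he⟩ := Fintype.exists_ne_map_eq_of_card_lt
      (fun i : Fin (Nat.card α + 1) => f^[(i : ℕ)] x) (by simp [Nat.card_eq_fintype_card])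
    wlog hlt : i < j generalizing i j
    · exact this j i hij.symm he.symm (lt_of_le_of_ne (not_lt.1 hlt) hij.symm)
    have hj := j.2
    have hlt' : (i : ℕ) < j := hlt
    -- As `f^[i] x = f^[j] x` with `i < j ≤ n`, the segment from `i` to `j` can be cut out of the
    -- orbit without changing its end.
    obtain ⟨m, hm, h⟩ := ih (n - j + i) (by omega)
    refine ⟨m, hm, h.trans ?_⟩
    rw [Function.iterate_add_apply]
    rw [he, ← Function.iterate_add_apply]
    congr 2
    omega

theorem natCard_set {α : Type*} [Finite α] : Nat.card (Set α) = 2 ^ Nat.card α := by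
  classical
  have := Fintype.ofFinite α
  rw [Nat.card_eq_fintype_card, Fintype.card_set, Nat.card_eq_fintype_card]

/-! ### Automata with a timer -/

/-- The valuation `v`, supplemented by a timer with value `x`. -/
def withTimer {C : Type} (x : ℝ≥0) (v : ClockValuation C) : ClockValuation (Option C) :=
  fun o => o.elim x v

theorem withTimer_delay {C : Type} (x d : ℝ≥0) (v : ClockValuation C) :
    (withTimer x v).delay d = withTimer (x + d) (v.delay d) := by
  funext o; cases o <;> rfl

theorem withTimer_reset {C : Type} (x : ℝ≥0) (v : ClockValuation C) (R : List C) :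
    (withTimer x v).reset (R.map some) = withTimer x (v.reset R) := by
  funext o
  rcases o with _ | c
  · simp [ClockValuation.reset, withTimer]
  · by_cases hc : c ∈ R <;> simp [ClockValuation.reset, withTimer, hc]

/-- The valuation `v` with the timer set to `x`. -/
def setTimer {C : Type} (x : ℝ≥0) (v : ClockValuation (Option C)) : ClockValuation (Option C) :=
  withTimer x fun c => v (some c)

@[simp] theorem setTimer_none {C : Type} (x : ℝ≥0) (v : ClockValuation (Option C)) :
    setTimer x v none = x := rfl

@[simp] theorem setTimer_some {C : Type} (x : ℝ≥0) (v : ClockValuation (Option C)) (c : C) :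
    setTimer x v (some c) = v (some c) := rfl

theorem setTimer_setTimer {C : Type} (x y : ℝ≥0) (v : ClockValuation (Option C)) :
    setTimer x (setTimer y v) = setTimer x v := by
  funext o; cases o <;> rfl

theorem setTimer_self {C : Type} (v : ClockValuation (Option C)) : setTimer (v none) v = v := by
  funext o; cases o <;> rfl

theorem setTimer_zero {C : Type} (v : ClockValuation (Option C)) :
    setTimer 0 v = v.reset [none] := by
  funext o; cases o <;> simp [ClockValuation.reset]

theorem setTimer_delay {C : Type} (x d : ℝ≥0) (v : ClockValuation (Option C)) :
    (setTimer x v).delay d = setTimer (x + d) (v.delay d) := by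
  funext o; cases o <;> rfl

theorem delay_delay {X : Type} (v : ClockValuation X) (d e : ℝ≥0) :
    (v.delay d).delay e = v.delay (d + e) := by
  funext o; simp [ClockValuation.delay, add_assoc]

theorem delay_zero {X : Type} (v : ClockValuation X) : v.delay 0 = v := by
  funext o; simp [ClockValuation.delay]

/-- The jump along `τ` of an automaton whose clocks are supplemented by a timer, the clock
`none`. -/
def TimerJump {Q Act C : Type} (τ : Transition Q Act C) (s s' : ENTA.State Q (Option C)) : Prop :=
  τ.source = s.1 ∧ ClockValuation.Satisfies (fun c => s.2 (some c)) τ.guard ∧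
    s' = (τ.target, s.2.reset (τ.resets.map some))

theorem TimerJump.timer_eq {Q Act C : Type} {τ : Transition Q Act C}
    {s s' : ENTA.State Q (Option C)} (h : TimerJump τ s s') : s'.2 none = s.2 none := by
  rw [h.2.2]; simp [ClockValuation.reset]

/-- Guards and resets of the automaton do not involve the timer, so a jump remains possible under
any other timer value. -/
theorem TimerJump.setTimer {Q Act C : Type} {τ : Transition Q Act C}
    {s s' : ENTA.State Q (Option C)} (h : TimerJump τ s s') (x : ℝ≥0) :
    TimerJump τ (s.1, setTimer x s.2) (s'.1, setTimer x s'.2) := by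
  obtain ⟨h1, h2, rfl⟩ := h
  refine ⟨h1, h2, Prod.ext rfl ?_⟩
  funext o
  cases o <;> simp [ClockValuation.reset, _root_.setTimer, withTimer]

/-- The class of a state: its location and its region. -/
def regionClass {Q X : Type} (K : ℕ) (s : ENTA.State Q X) : Q × Set (RegionAtom X K) :=
  (s.1, region K s.2)

theorem regionClass_eq_iff {Q X : Type} {K : ℕ} {s w : ENTA.State Q X} :
    regionClass K s = regionClass K w ↔ s.1 = w.1 ∧ RegionEq K s.2 w.2 := by
  rw [← region_eq_iff, regionClass, regionClass, Prod.mk.injEq]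

/-- Setting the timer to `0` is a reset, hence compatible with regions. -/
theorem regionClass_setTimer_zero {Q C : Type} {K : ℕ} {s w : ENTA.State Q (Option C)}
    (h : regionClass K s = regionClass K w) :
    regionClass K (s.1, setTimer 0 s.2) = regionClass K (w.1, setTimer 0 w.2) := by
  rw [regionClass_eq_iff] at h ⊢
  refine ⟨h.1, ?_⟩
  simp only [setTimer_zero]
  exact h.2.reset _

namespace ENTA

variable {Q Act C : Type} (A : ENTA Q Act C)

/-- All constants in guards are at most `K`. -/
def BoundedBy (K : ℕ) : Prop := ∀ τ ∈ A.transitions, ∀ φ ∈ τ.guard, φ.bound ≤ K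

/-- A delay by an amount that satisfies `D`, or a silent jump. -/
def SilentMove (D : ℝ≥0 → Prop) (s s' : State Q (Option C)) : Prop :=
  (∃ d, D d ∧ s' = (s.1, s.2.delay d)) ∨
    ∃ τ ∈ A.transitions, τ.label = none ∧ TimerJump τ s s'

/-- Reachability by delays and silent jumps. -/
def SilentReach : State Q (Option C) → State Q (Option C) → Prop :=
  Relation.ReflTransGen (A.SilentMove fun _ => True)

variable {A}

theorem SilentMove.mono {D D' : ℝ≥0 → Prop} (hD : ∀ d, D d → D' d) {s s' : State Q (Option C)}
    (h : A.SilentMove D s s') : A.SilentMove D' s s' := by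
  rcases h with ⟨d, hd, h⟩ | h
  · exact .inl ⟨d, hD d hd, h⟩
  · exact .inr h

theorem SilentReach.delay {s s' : State Q (Option C)} (h : A.SilentReach s s') (d : ℝ≥0) :
    A.SilentReach s (s'.1, s'.2.delay d) :=
  Relation.ReflTransGen.tail h (.inl ⟨d, trivial, rfl⟩)

/-- The number `e` is the elapsed time. Since moves ignore the timer, the same path can be followed
from any initial timer value, which allows shifting the time origin. -/
theorem SilentReach.exists_timer_eq {s s' : State Q (Option C)} (h : A.SilentReach s s') :
    ∃ e, s'.2 none = s.2 none + e ∧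
      ∀ x, A.SilentReach (s.1, setTimer x s.2) (s'.1, setTimer (x + e) s'.2) := by
  induction h with
  | refl => exact ⟨0, by simp, fun x => by rw [add_zero]; exact .refl⟩
  | tail _ hm ih =>
    obtain ⟨e, he, ih⟩ := ih
    rcases hm with ⟨d, -, rfl⟩ | ⟨τ, hτ, hl, hj⟩
    · refine ⟨e + d, by simp [ClockValuation.delay, he, add_assoc], fun x => ?_⟩
      rw [← add_assoc, ← setTimer_delay]
      exact (ih x).delay d
    · exact ⟨e, by rw [hj.timer_eq, he],
        fun x => Relation.ReflTransGen.tail (ih x) (.inr ⟨τ, hτ, hl, hj.setTimer _⟩)⟩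

/-- The timer changes only during delays, so the delay that passes `x` can be split at `x`. -/
theorem SilentReach.exists_between {s s' : State Q (Option C)} (h : A.SilentReach s s') {x : ℝ≥0}
    (hx : s.2 none ≤ x) (hx' : x ≤ s'.2 none) :
    ∃ m, A.SilentReach s m ∧ m.2 none = x ∧ A.SilentReach m s' := by
  induction h with
  | refl => exact ⟨s, .refl, le_antisymm hx hx', .refl⟩
  | @tail b c hb hm ih =>
    by_cases hxb : x ≤ b.2 none
    · obtain ⟨m, h1, h2, h3⟩ := ih hxb
      exact ⟨m, h1, h2, h3.tail hm⟩
    rcases hm with ⟨d, -, rfl⟩ | ⟨τ, hτ, hl, hj⟩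
    · obtain ⟨e, rfl⟩ := exists_add_of_le (not_le.1 hxb).le
      simp only [ClockValuation.delay, add_le_add_iff_left] at hx'
      obtain ⟨e', rfl⟩ := exists_add_of_le hx'
      refine ⟨_, SilentReach.delay hb e, rfl, .single (.inl ⟨e', trivial, ?_⟩)⟩
      rw [delay_delay]
    · rw [hj.timer_eq] at hx'
      exact absurd hx' hxb

/-! ### Matching silent moves within regions, on dyadic grids -/

/-- The state is on the grid of multiples of `2⁻ⁱ`. -/
def _root_.StateOnGrid {Q X : Type} (i : ℕ) (s : State Q X) : Prop := ∀ x, OnGrid i (s.2 x)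

theorem _root_.TimerJump.stateOnGrid {τ : Transition Q Act C} {s s' : State Q (Option C)}
    (h : TimerJump τ s s') {i : ℕ} (hs : StateOnGrid i s) : StateOnGrid i s' := by
  intro x
  rw [h.2.2]
  simp only [ClockValuation.reset]
  split_ifs
  · exact OnGrid.zero i
  · exact hs x

theorem _root_.TimerJump.exists_of_regionClass_eq {K : ℕ} (hK : A.BoundedBy K)
    {τ : Transition Q Act C} (hτ : τ ∈ A.transitions) {s s' w : State Q (Option C)}
    (h : TimerJump τ s s') (hsw : regionClass K s = regionClass K w) :
    ∃ w', TimerJump τ w w' ∧ regionClass K s' = regionClass K w' := by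
  rw [regionClass_eq_iff] at hsw
  obtain ⟨h1, h2, rfl⟩ := h
  refine ⟨_, ⟨h1.trans hsw.1, fun φ hφ => ?_, rfl⟩,
    regionClass_eq_iff.2 ⟨rfl, hsw.2.reset _⟩⟩
  exact (hsw.2.cmp_holds _ (hK τ hτ φ hφ) _).1 (h2 φ hφ)

/-- The bisimulation step. The bounds on the matching delay depend on `w` alone, whatever delay was
taken from `s`. -/
theorem SilentMove.exists_of_regionClass_eq [Finite C] {K : ℕ} (hK : A.BoundedBy K)
    {D : ℝ≥0 → Prop} {s s' w : State Q (Option C)} (h : A.SilentMove D s s')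
    (hsw : regionClass K s = regionClass K w) :
    ∃ w', A.SilentMove (fun d => d ≤ K + 1 ∧ ∀ i, StateOnGrid i w → OnGrid (i + 1) d) w w' ∧
      regionClass K s' = regionClass K w' ∧ ∀ i, StateOnGrid i w → StateOnGrid (i + 1) w' := by
  rcases h with ⟨d, -, rfl⟩ | ⟨τ, hτ, hl, hj⟩
  · rw [regionClass_eq_iff] at hsw
    obtain ⟨d', h1, h2, h3⟩ := hsw.2.exists_delay d
    refine ⟨(w.1, w.2.delay d'), .inl ⟨d', ⟨h1, h2⟩, rfl⟩, regionClass_eq_iff.2 ⟨hsw.1, h3⟩, ?_⟩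
    exact fun i hi x => ((hi x).mono (Nat.le_succ i)).add (h2 i hi)
  · obtain ⟨w', h1, h2⟩ := hj.exists_of_regionClass_eq hK hτ hsw
    exact ⟨w', .inr ⟨τ, hτ, hl, h1⟩, h2,
      fun i hi x => (h1.stateOnGrid hi x).mono (Nat.le_succ i)⟩

theorem SilentReach.exists_of_regionClass_eq [Finite C] {K : ℕ} (hK : A.BoundedBy K)
    {s s' w : State Q (Option C)} (h : A.SilentReach s s')
    (hsw : regionClass K s = regionClass K w) :
    ∃ w', A.SilentReach w w' ∧ regionClass K s' = regionClass K w' := by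
  induction h with
  | refl => exact ⟨w, .refl, hsw⟩
  | tail _ hm ih =>
    obtain ⟨w₁, h1, h2⟩ := ih
    obtain ⟨w₂, h3, h4, -⟩ := hm.exists_of_regionClass_eq hK h2
    exact ⟨w₂, h1.tail (h3.mono fun _ _ => trivial), h4⟩

/-- A path in the quotient graph can be taken of length exactly `N`, the number of classes, and is
then lifted edge by edge from `w`. Each lifted move refines the grid by at most one halving, so `N`
further binary digits suffice. -/
theorem SilentReach.exists_reachIn_grid [Finite Q] [Finite C] {K : ℕ} (hK : A.BoundedBy K)
    {s s' w : State Q (Option C)} (h : A.SilentReach s s')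
    (hsw : regionClass K s = regionClass K w) {N : ℕ}
    (hN : N = Nat.card (Q × Set (RegionAtom (Option C) K))) {i P : ℕ} (hP : i + N ≤ P)
    (hw : StateOnGrid i w) :
    ∃ w', ReachIn (A.SilentMove (GridDelay K P)) N w w' ∧
      regionClass K s' = regionClass K w' ∧ StateOnGrid (i + N) w' := by
  -- An edge needs a move between some representatives only; the bisimulation transfers it to the
  -- state at hand. The added loops, lifted as delays of length `0`, pad paths to the exact length.
  set E : Q × Set (RegionAtom (Option C) K) → Q × Set (RegionAtom (Option C) K) → Prop :=
    fun c c' => c = c' ∨ ∃ s s', regionClass K s = c ∧ regionClass K s' = c' ∧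
      A.SilentMove (fun _ => True) s s' with hE
  have hpath : Relation.ReflTransGen E (regionClass K s) (regionClass K s') :=
    Relation.ReflTransGen.lift (regionClass K) (fun a b hab => Or.inr ⟨a, b, rfl, rfl, hab⟩) _ _ h
  have hpath := reachIn_card_of_reflTransGen (fun c => .inl rfl) hpath
  rw [← hN, hsw] at hpath
  clear hN
  generalize regionClass K s' = c at hpath
  induction N generalizing c with
  | zero => exact ⟨w, rfl, hpath.symm, hw⟩
  | succ N ih =>
    obtain ⟨c₁, h1, h2⟩ := hpath
    obtain ⟨w₁, h3, rfl, h5⟩ := ih (by omega) c₁ h1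
    rcases h2 with rfl | ⟨t, t', ht, rfl, hm⟩
    · refine ⟨w₁, ⟨w₁, h3, .inl ⟨0, ⟨zero_le, OnGrid.zero P⟩, ?_⟩⟩, rfl,
        fun x => (h5 x).mono (by omega)⟩
      rw [delay_zero]
    · obtain ⟨w₂, h6, h7, h8⟩ := hm.exists_of_regionClass_eq hK ht
      exact ⟨w₂, ⟨w₁, h3, h6.mono fun d hd => ⟨hd.1, (hd.2 _ h5).mono (by omega)⟩⟩, h7, h8 _ h5⟩

/-- From the state `s`, the automaton can emit the action `a` when the timer satisfies `P`, with
nothing else observable, and end in an accepting location. -/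
def Observes (A : ENTA Q Act C) (a : Act) (P : ℝ≥0 → Prop) (s : State Q (Option C)) : Prop :=
  ∃ s₁ s₂ s₃ τ, A.SilentReach s s₁ ∧ P (s₁.2 none) ∧ τ ∈ A.transitions ∧ τ.label = some a ∧
    TimerJump τ s₁ s₂ ∧ A.SilentReach s₂ s₃ ∧ s₃.1 ∈ A.accepting

/-- The property `P` of the timer depends on the region only. -/
def _root_.RegionInvariant (C : Type) (K : ℕ) (P : ℝ≥0 → Prop) : Prop :=
  ∀ v w : ClockValuation (Option C), RegionEq K v w → P (v none) → P (w none)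

theorem Observes.of_regionClass_eq [Finite C] {K : ℕ} (hK : A.BoundedBy K) {a : Act}
    {P : ℝ≥0 → Prop} (hP : RegionInvariant C K P) {s w : State Q (Option C)}
    (h : A.Observes a P s) (hsw : regionClass K s = regionClass K w) : A.Observes a P w := by
  obtain ⟨s₁, s₂, s₃, τ, h1, h2, h3, h4, h5, h6, h7⟩ := h
  obtain ⟨w₁, g1, e1⟩ := h1.exists_of_regionClass_eq hK hsw
  obtain ⟨w₂, g2, e2⟩ := h5.exists_of_regionClass_eq hK h3 e1
  obtain ⟨w₃, g3, e3⟩ := h6.exists_of_regionClass_eq hK e2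
  refine ⟨w₁, w₂, w₃, τ, g1, hP _ _ (regionClass_eq_iff.1 e1).2 h2, h3, h4, g2, g3, ?_⟩
  rw [← (regionClass_eq_iff.1 e3).1]
  exact h7

/-! ### Runs and silent reachability -/

/-- The initial state with the timer set to `x`. -/
def start (A : ENTA Q Act C) (x : ℝ≥0) : State Q (Option C) :=
  (A.init, withTimer x fun _ => 0)

/-- The timer reads the offset `x` plus the elapsed time. Runs with empty and with one-letter
observable trace are treated together, because the second kind extends the first at its emission. -/
theorem Run.silentReach {s : State Q C} {t : ℝ≥0} {l : Trace (Option Act)} (h : A.Run s t l)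
    (x : ℝ≥0) :
    (l.observable = [] → A.SilentReach (A.start x) (s.1, withTimer (x + t) s.2)) ∧
    ∀ t' a, l.observable = [(t', a)] → ∃ s₁ s₂ τ, A.SilentReach (A.start x) s₁ ∧
      s₁.2 none = x + t' ∧ τ ∈ A.transitions ∧ τ.label = some a ∧ TimerJump τ s₁ s₂ ∧
      A.SilentReach s₂ (s.1, withTimer (x + t) s.2) := by
  induction h with
  | start =>
    refine ⟨fun _ => ?_, fun t' a h => by simp [Trace.observable] at h⟩
    rw [add_zero]
    exact .refl
  | @step s s₁ s₂ t l d τ _ hd hj ih =>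
    obtain ⟨hd1, hd2⟩ := hd
    obtain ⟨hj1, hj2, hj3, hj4, hj5⟩ := hj
    have hjump : TimerJump τ (s.1, withTimer (x + (t + d)) (s.2.delay d))
        (s₂.1, withTimer (x + (t + d)) s₂.2) := by
      refine ⟨hj2.trans hd1, hd2 ▸ hj3, Prod.ext hj4 ?_⟩
      simp only [withTimer_reset, hj5, hd2]
    have hdelay : (withTimer (x + t) s.2).delay d =
        withTimer (x + (t + d)) (s.2.delay d) := by
      rw [withTimer_delay, add_assoc]
    cases hl : τ.label with
    | none =>
      have hobs : Trace.observable (l ++ [(t + d, none)]) = l.observable := by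
        simp [Trace.observable]
      rw [hobs]
      refine ⟨fun h => ?_, fun t' a h => ?_⟩
      · have := (ih.1 h).delay d
        rw [hdelay] at this
        exact this.tail (.inr ⟨τ, hj1, hl, hjump⟩)
      · obtain ⟨u, u', τ', h1, h2, h3, h4, h5, h6⟩ := ih.2 t' a h
        have := h6.delay d
        rw [hdelay] at this
        exact ⟨u, u', τ', h1, h2, h3, h4, h5, this.tail (.inr ⟨τ, hj1, hl, hjump⟩)⟩
    | some b =>
      have hobs : Trace.observable (l ++ [(t + d, some b)]) = l.observable ++ [(t + d, b)] := by
        simp [Trace.observable]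
      rw [hobs]
      refine ⟨fun h => by simp at h, fun t' a h => ?_⟩
      obtain ⟨h1, h2⟩ := List.append_inj' (t₁ := [(t + d, b)]) (s₂ := []) h rfl
      simp only [List.cons.injEq, Prod.mk.injEq, and_true] at h2
      obtain ⟨rfl, rfl⟩ := h2
      have := (ih.1 h1).delay d
      rw [hdelay] at this
      exact ⟨_, _, τ, this, rfl, hj1, hl, hjump, .refl⟩

/-- A run ends with a jump, a silent path possibly with delays. The unfinished delay `d` is carried
along and used up by the next jump. -/
theorem Run.exists_of_silentReach {s : State Q C} {t : ℝ≥0} {l : Trace (Option Act)}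
    (h : A.Run s t l) {x : ℝ≥0} {s' : State Q (Option C)}
    (hs : A.SilentReach (s.1, withTimer (x + t) s.2) s') :
    ∃ u t' l' d, A.Run u t' l' ∧ l'.observable = l.observable ∧
      s' = (u.1, withTimer (x + (t' + d)) (u.2.delay d)) := by
  induction hs with
  | refl => exact ⟨s, t, l, 0, h, rfl, by rw [add_zero, delay_zero]⟩
  | tail _ hm ih =>
    obtain ⟨u, t', l', d, h1, h2, rfl⟩ := ih
    rcases hm with ⟨e, -, rfl⟩ | ⟨τ, hτ, hl, hj1, hj2, rfl⟩
    · refine ⟨u, t', l', d + e, h1, h2, Prod.ext rfl ?_⟩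
      simp only [withTimer_delay, delay_delay, add_assoc]
    · refine ⟨(τ.target, (u.2.delay d).reset τ.resets), _, _, 0,
        h1.step (s₁ := (u.1, u.2.delay d)) d τ ⟨rfl, rfl⟩ ⟨hτ, hj1, hj2, rfl, rfl⟩, ?_,
        Prod.ext rfl ?_⟩
      · rw [← h2, hl]; simp [Trace.observable]
      · simp only [withTimer_reset, delay_zero, add_zero]

theorem nil_mem_language_iff :
    [] ∈ A.language ↔ ∃ s, A.SilentReach (A.start 0) s ∧ s.1 ∈ A.accepting := by
  constructor
  · rintro ⟨s, t, l, h, hacc, hl⟩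
    exact ⟨_, (h.silentReach 0).1 hl, hacc⟩
  · rintro ⟨s, h, hacc⟩
    have h0 : A.start 0 = (A.init, withTimer (0 + 0) fun _ => 0) := by rw [add_zero]; rfl
    rw [h0] at h
    obtain ⟨u, t, l, d, h1, h2, rfl⟩ := Run.start.exists_of_silentReach h
    exact ⟨u, t, l, h1, hacc, by rw [h2]; rfl⟩

/-- The free offset `x` is the point: it turns the time `t` into the timer value `x + t`, which can
be made an integer. -/
theorem singleton_mem_language_iff (x t : ℝ≥0) (a : Act) :
    [(t, a)] ∈ A.language ↔ A.Observes a (fun y => y = x + t) (A.start x) := by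
  constructor
  · rintro ⟨s, t', l, h, hacc, hl⟩
    obtain ⟨s₁, s₂, τ, h1, h2, h3, h4, h5, h6⟩ := (h.silentReach x).2 t a hl
    exact ⟨s₁, s₂, _, τ, h1, h2, h3, h4, h5, h6, hacc⟩
  · rintro ⟨s₁, s₂, s₃, τ, h1, h2, h3, h4, h5, h6, h7⟩
    have h0 : A.start x = (A.init, withTimer (x + 0) fun _ => 0) := by rw [add_zero]; rfl
    rw [h0] at h1
    obtain ⟨u, t', l, d, g1, g2, rfl⟩ := Run.start.exists_of_silentReach h1
    simp only [withTimer, Option.elim, add_right_inj] at h2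
    obtain ⟨hj1, hj2, rfl⟩ := h5
    have hrun := g1.step (s₁ := (u.1, u.2.delay d))
      (s₂ := (τ.target, (u.2.delay d).reset τ.resets)) d τ ⟨rfl, rfl⟩ ⟨h3, hj1, hj2, rfl, rfl⟩
    rw [withTimer_reset] at h6
    obtain ⟨u', t'', l', d', k1, k2, rfl⟩ := hrun.exists_of_silentReach h6
    refine ⟨u', t'', l', k1, h7, ?_⟩
    rw [k2, h4, ← h2]
    have : Trace.observable (l ++ [(t' + d, some a)]) = l.observable ++ [(t' + d, a)] := by
      simp [Trace.observable]
    rw [this, g2]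
    rfl

/-! ### Cells of the time axis -/

/-- The cells of the time axis: the points `k` and the open intervals `(k, k + 1)`. -/
def _root_.InCell (k : ℕ) : Bool → ℝ≥0 → Prop
  | false, t => t = k
  | true, t => k < t ∧ t < k + 1

theorem _root_.exists_inCell (t : ℝ≥0) : ∃ k b, InCell k b t := by
  rcases (Nat.floor_le (zero_le (a := t))).eq_or_lt with h | h
  · exact ⟨⌊t⌋₊, false, h.symm⟩
  · exact ⟨⌊t⌋₊, true, h, Nat.lt_floor_add_one t⟩

theorem _root_.exists_of_inCell (k : ℕ) (b : Bool) : ∃ t, InCell k b t := by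
  cases b
  · exact ⟨k, rfl⟩
  · exact ⟨k + 1 / 2, by simp, by
      rw [add_lt_add_iff_left, ← NNReal.coe_lt_coe]; norm_num⟩

theorem _root_.regionInvariant_inCell {K k : ℕ} (b : Bool) (hk : k + 1 ≤ K) :
    RegionInvariant C K (InCell k b) := by
  intro v w h hv
  cases b
  · exact (h.cmp_holds none (by omega) .eq).1 hv
  · refine ⟨(h.cmp_holds none (by omega) .gt).1 hv.1, ?_⟩
    have := (h.cmp_holds none hk .lt).1 (by push_cast; exact hv.2)
    push_cast at this
    exact this

theorem exists_boundedBy (A : ENTA Q Act C) : ∃ K, A.BoundedBy K := by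
  have : (⋃ τ ∈ {τ | τ ∈ A.transitions}, ⋃ φ ∈ {φ | φ ∈ τ.guard}, {φ.bound}).Finite :=
    (List.finite_toSet _).biUnion fun τ _ => (List.finite_toSet _).biUnion fun φ _ =>
      Set.finite_singleton _
  obtain ⟨K, hK⟩ := this.bddAbove
  refine ⟨K, fun τ hτ φ hφ => hK ?_⟩
  simp only [Set.mem_iUnion]
  exact ⟨τ, hτ, φ, hφ, rfl⟩

theorem BoundedBy.mono {K K' : ℕ} (h : A.BoundedBy K) (hK : K ≤ K') : A.BoundedBy K' :=
  fun τ hτ φ hφ => (h τ hτ φ hφ).trans hK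

/-- Membership of the trace `(t, a)` depends only on the cell of `t`. -/
theorem singleton_mem_language_of_inCell [Finite C] {k : ℕ} {b : Bool} {t t' : ℝ≥0}
    (ht : InCell k b t) (ht' : InCell k b t') {a : Act} (h : [(t, a)] ∈ A.language) :
    [(t', a)] ∈ A.language := by
  cases b
  · cases ht; cases ht'; exact h
  -- The offsets are `x = k + 1 - t` and `x' = k + 1 - t'`, both in `(0, 1)`; emission then happens
  -- at timer value `k + 1` in either case.
  obtain ⟨x, hx⟩ := exists_add_of_le ht.2.le
  obtain ⟨x', hx'⟩ := exists_add_of_le ht'.2.le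
  have hpos : ∀ {t x : ℝ≥0}, InCell k true t → (k : ℝ≥0) + 1 = t + x → 0 < x ∧ x < 1 := by
    intro t x ht hx
    constructor
    · rw [← add_lt_add_iff_left t, ← hx, add_zero]; exact ht.2
    · rw [← add_lt_add_iff_left t, ← hx, add_lt_add_iff_right]; exact ht.1
  have hx0 := hpos ht hx
  have hx0' := hpos ht' hx'
  obtain ⟨K₀, hK₀⟩ := A.exists_boundedBy
  set K := max K₀ (k + 1)
  have hK : A.BoundedBy K := hK₀.mono (le_max_left _ _)
  have hkK : k + 1 ≤ K := le_max_right _ _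
  rw [singleton_mem_language_iff x, add_comm, ← hx] at h
  rw [singleton_mem_language_iff x', add_comm, ← hx']
  have hinv : RegionInvariant C K fun y => y = (k : ℝ≥0) + 1 := by
    intro v w hvw hv
    have := (hvw.cmp_holds none hkK .eq).1 (by push_cast; exact hv)
    push_cast at this
    exact this
  refine h.of_regionClass_eq hK hinv (regionClass_eq_iff.2 ⟨rfl, ?_⟩)
  -- All numbers in `(0, 1)` compare alike with natural numbers, and the other clocks are `0`, so
  -- the two starts lie in one region.
  have hone : ∀ {x : ℝ≥0}, 0 < x ∧ x < 1 → ∀ n : ℕ, (x ≤ n ↔ 1 ≤ n) ∧ ((n : ℝ≥0) ≤ x ↔ n = 0) := by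
    intro x hx n
    constructor
    · refine ⟨fun h => ?_, fun h => hx.2.le.trans (by exact_mod_cast h)⟩
      have : (0 : ℝ≥0) < n := hx.1.trans_le h
      exact_mod_cast this
    · refine ⟨fun h => ?_, fun h => by rw [h]; simp⟩
      have : (n : ℝ≥0) < 1 := h.trans_lt hx.2
      have : n < 1 := by exact_mod_cast this
      omega
  have hzero : ∀ {x : ℝ≥0}, 0 < x ∧ x < 1 → ¬ x ≤ 0 := fun hx => not_le.2 hx.1
  change RegionEq K (setTimer x fun _ => 0) (setTimer x' fun _ => 0)
  constructor
  · rintro (_ | c) n -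
    · exact ((hone hx0 n).1).trans ((hone hx0' n).1).symm
    · exact Iff.rfl
  · rintro (_ | c) n -
    · exact ((hone hx0 n).2).trans ((hone hx0' n).2).symm
    · exact Iff.rfl
  · rintro (_ | c) (_ | c') - - n -
    · simp
    · simp only [setTimer_none, setTimer_some, zero_add]
      exact ((hone hx0 n).1).trans ((hone hx0' n).1).symm
    · simp
    · simp
  · rintro (_ | c) (_ | c') - - n -
    · simp
    · simp only [setTimer_none, setTimer_some, nonpos_iff_eq_zero, add_eq_zero]
      rw [eq_false hx0.1.ne', eq_false hx0'.1.ne']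
    · simp only [setTimer_none, setTimer_some, zero_add]
      exact ((hone hx0 n).2).trans ((hone hx0' n).2).symm
    · simp

/-- Some, equivalently every, trace `(t, a)` with `t` in the given cell is in the language. -/
def CellObserved (A : ENTA Q Act C) (a : Act) (k : ℕ) (b : Bool) : Prop :=
  A.Observes a (InCell k b) (A.start 0)

theorem cellObserved_iff [Finite C] {a : Act} {k : ℕ} {b : Bool} {t : ℝ≥0} (ht : InCell k b t) :
    A.CellObserved a k b ↔ [(t, a)] ∈ A.language := by
  constructor
  · rintro ⟨s₁, s₂, s₃, τ, h1, h2, h⟩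
    refine singleton_mem_language_of_inCell h2 ht ?_
    rw [singleton_mem_language_iff 0]
    exact ⟨s₁, s₂, s₃, τ, h1, (zero_add _).symm, h⟩
  · intro h
    rw [singleton_mem_language_iff 0] at h
    obtain ⟨s₁, s₂, s₃, τ, h1, h2, h⟩ := h
    rw [zero_add] at h2
    exact ⟨s₁, s₂, s₃, τ, h1, h2 ▸ ht, h⟩

theorem boundedUniversal_one_iff [Finite C] :
    A.BoundedUniversal 1 ↔ [] ∈ A.language ∧ ∀ a k b, A.CellObserved a k b := by
  constructor
  · intro h
    refine ⟨(h [] List.Pairwise.nil (by simp)).1, fun a k b => ?_⟩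
    obtain ⟨t, ht⟩ := exists_of_inCell k b
    rw [cellObserved_iff ht]
    exact (h [(t, a)] (List.pairwise_singleton _ _) (by simp)).1
  · rintro ⟨h0, h1⟩ w - hw
    refine ⟨?_, hw⟩
    rcases w with _ | ⟨⟨t, a⟩, _ | ⟨y, w⟩⟩
    · exact h0
    · obtain ⟨k, b, ht⟩ := exists_inCell t
      exact (cellObserved_iff ht).1 (h1 a k b)
    · simp at hw

/-! ### Periodicity -/

/-- The classes, with the timer set back to `0`, of the states that are silently reachable at
time `k`. -/
def classesAt (A : ENTA Q Act C) (K k : ℕ) : Set (Q × Set (RegionAtom (Option C) K)) :=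
  {c | ∃ s, A.SilentReach (A.start 0) s ∧ s.2 none = k ∧
    regionClass K (s.1, setTimer 0 s.2) = c}

/-- The classes that are reached from those in `S` after one unit of time. -/
def nextClasses (A : ENTA Q Act C) (K : ℕ) (S : Set (Q × Set (RegionAtom (Option C) K))) :
    Set (Q × Set (RegionAtom (Option C) K)) :=
  {c | ∃ s s', regionClass K s ∈ S ∧ s.2 none = 0 ∧ A.SilentReach s s' ∧ s'.2 none = 1 ∧
    regionClass K (s'.1, setTimer 0 s'.2) = c}

/-- A path to time `k + 1` is cut at time `k`, and the second part is shifted so that it runs from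
timer value `0` to `1`. Conversely, such a unit path is transferred to the actual state reached at
time `k` and shifted back. The constant must be at least `1` so that regions recognise the timer
value `1`. -/
theorem classesAt_succ [Finite C] {K : ℕ} (hK : A.BoundedBy K) (hK1 : 1 ≤ K) (k : ℕ) :
    A.classesAt K (k + 1) = A.nextClasses K (A.classesAt K k) := by
  ext c
  constructor
  · rintro ⟨s, h, hs, rfl⟩
    obtain ⟨m, h1, h2, h3⟩ := h.exists_between (x := k) (zero_le) (by rw [hs]; simp)
    obtain ⟨e, h4, h5⟩ := h3.exists_timer_eq
    have he : e = 1 := by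
      rw [h2, hs] at h4; push_cast at h4; exact (add_left_cancel h4).symm
    refine ⟨_, _, ⟨m, h1, h2, rfl⟩, rfl, h5 0, by simp [he], ?_⟩
    simp only [setTimer_setTimer]
  · rintro ⟨s, s', ⟨m, h1, h2, h3⟩, h4, h5, h6, rfl⟩
    obtain ⟨w, h7, h8⟩ := h5.exists_of_regionClass_eq hK h3.symm
    have hw : w.2 none = 1 := by
      have := ((regionClass_eq_iff.1 h8).2.cmp_holds none hK1 .eq).1 (by rw [h6]; simp [Cmp.Holds])
      simpa [Cmp.Holds] using this
    obtain ⟨e, h9, h10⟩ := h7.exists_timer_eq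
    have he : e = 1 := by rw [hw] at h9; simpa using h9.symm
    have h11 := h10 k
    simp only [setTimer_setTimer] at h11
    rw [← h2, setTimer_self, he] at h11
    refine ⟨_, Relation.ReflTransGen.trans h1 h11, ?_, ?_⟩
    · simp [h2]
    · simp only [setTimer_setTimer]
      exact (regionClass_setTimer_zero h8).symm

/-- Cutting at time `k` and shifting the timer back turns the cell at `k` into the cell at `0`, so
`k` enters only through the set of classes and `K` need not grow with it. -/
theorem cellObserved_iff_classesAt [Finite C] {K : ℕ} (hK : A.BoundedBy K) (hK1 : 1 ≤ K) (a : Act)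
    (k : ℕ) (b : Bool) :
    A.CellObserved a k b ↔
      ∃ s, regionClass K s ∈ A.classesAt K k ∧ A.Observes a (InCell 0 b) s := by
  have hcell : ∀ e, InCell k b (k + e) ↔ InCell 0 b e := by
    intro e; cases b <;> simp [InCell]
  constructor
  · rintro ⟨s₁, s₂, s₃, τ, h1, h2, h3, h4, h5, h6, h7⟩
    have hk : (k : ℝ≥0) ≤ s₁.2 none := by
      cases b
      · exact (show s₁.2 none = k from h2).ge
      · exact h2.1.le
    obtain ⟨m, g1, g2, g3⟩ := h1.exists_between (x := k) (zero_le) hk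
    obtain ⟨e, g4, g5⟩ := g3.exists_timer_eq
    obtain ⟨e', -, g7⟩ := h6.exists_timer_eq
    refine ⟨_, ⟨m, g1, g2, rfl⟩, _, _, _, τ, g5 0, ?_, h3, h4, h5.setTimer _, g7 _, h7⟩
    rw [g4, g2, hcell] at h2
    simpa using h2
  · rintro ⟨s, ⟨m, h1, h2, h3⟩, h4⟩
    obtain ⟨s₁, s₂, s₃, τ, g1, g2, g3, g4, g5, g6, g7⟩ :=
      h4.of_regionClass_eq hK (regionInvariant_inCell b (by omega)) h3.symm
    obtain ⟨e, k1, k2⟩ := g1.exists_timer_eq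
    obtain ⟨e', -, k4⟩ := g6.exists_timer_eq
    have k5 := k2 k
    simp only [setTimer_setTimer] at k5
    rw [← h2, setTimer_self] at k5
    refine ⟨_, _, _, τ, Relation.ReflTransGen.trans h1 k5, ?_, g3, g4, g5.setTimer _, k4 _, g7⟩
    rw [k1] at g2
    simp only [setTimer_none, zero_add] at g2
    change InCell k b (m.2 none + e)
    rw [h2, hcell]
    exact g2

/-- The sets of classes form an orbit in a power set, so each of them already occurs at an index
below its cardinality. -/
theorem cellObserved_forall_of_lt [Finite Q] [Finite C] {K : ℕ} (hK : A.BoundedBy K) (hK1 : 1 ≤ K)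
    (h : ∀ k < 2 ^ Nat.card (Q × Set (RegionAtom (Option C) K)), ∀ a b, A.CellObserved a k b)
    (a : Act) (k : ℕ) (b : Bool) : A.CellObserved a k b := by
  have hiter : ∀ k, A.classesAt K k = (A.nextClasses K)^[k] (A.classesAt K 0) := by
    intro k
    induction k with
    | zero => rfl
    | succ k ih => rw [classesAt_succ hK hK1, ih, Function.iterate_succ_apply']
  obtain ⟨m, hm, he⟩ := exists_iterate_eq_of_lt_card (A.nextClasses K) (A.classesAt K 0) k
  rw [natCard_set] at hm
  rw [← hiter, ← hiter] at he
  rw [cellObserved_iff_classesAt hK hK1, ← he, ← cellObserved_iff_classesAt hK hK1]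
  exact h m hm a b

/-! ### Short runs on a grid -/

theorem _root_.ReachIn.silentReach {D : ℝ≥0 → Prop} {n : ℕ} {s s' : State Q (Option C)}
    (h : ReachIn (A.SilentMove D) n s s') : A.SilentReach s s' :=
  (h.mono fun _ _ h => h.mono fun _ _ => trivial).reflTransGen

theorem _root_.stateOnGrid_start (A : ENTA Q Act C) : StateOnGrid 0 (A.start 0) := by
  rintro (_ | c) <;> exact OnGrid.zero 0

/-- The silent paths before and after the emission take `N` moves each and the jump itself refines
nothing, whence the grid `2⁻²ᴺ`. The bound on `k` makes the cell a union of regions. -/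
theorem cellObserved_iff_grid [Finite Q] [Finite C] {K : ℕ} (hK : A.BoundedBy K) {k : ℕ}
    (hk : k + 1 ≤ K) (a : Act) (b : Bool) {N : ℕ}
    (hN : N = Nat.card (Q × Set (RegionAtom (Option C) K))) :
    A.CellObserved a k b ↔ ∃ s₁ s₂ s₃ τ,
      ReachIn (A.SilentMove (GridDelay K (2 * N))) N (A.start 0) s₁ ∧ InCell k b (s₁.2 none) ∧
      τ ∈ A.transitions ∧ τ.label = some a ∧ TimerJump τ s₁ s₂ ∧
      ReachIn (A.SilentMove (GridDelay K (2 * N))) N s₂ s₃ ∧ s₃.1 ∈ A.accepting := by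
  constructor
  · rintro ⟨s₁, s₂, s₃, τ, h1, h2, h3, h4, h5, h6, h7⟩
    obtain ⟨w₁, g1, e1, o1⟩ := h1.exists_reachIn_grid hK rfl hN (P := 2 * N) (by omega)
      (stateOnGrid_start A)
    obtain ⟨w₂, g2, e2⟩ := h5.exists_of_regionClass_eq hK h3 e1
    obtain ⟨w₃, g3, e3, -⟩ := h6.exists_reachIn_grid hK e2 hN (P := 2 * N) (by omega)
      (g2.stateOnGrid o1)
    refine ⟨w₁, w₂, w₃, τ, g1,
      regionInvariant_inCell b hk _ _ (regionClass_eq_iff.1 e1).2 h2, h3, h4, g2, g3, ?_⟩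
    rw [← (regionClass_eq_iff.1 e3).1]
    exact h7
  · rintro ⟨s₁, s₂, s₃, τ, h1, h2, h3, h4, h5, h6, h7⟩
    exact ⟨s₁, s₂, s₃, τ, h1.silentReach, h2, h3, h4, h5, h6.silentReach, h7⟩

theorem nil_mem_language_iff_grid [Finite Q] [Finite C] {K : ℕ} (hK : A.BoundedBy K) {N : ℕ}
    (hN : N = Nat.card (Q × Set (RegionAtom (Option C) K))) :
    [] ∈ A.language ↔ ∃ s,
      ReachIn (A.SilentMove (GridDelay K (2 * N))) N (A.start 0) s ∧ s.1 ∈ A.accepting := by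
  rw [nil_mem_language_iff]
  constructor
  · rintro ⟨s, h, hs⟩
    obtain ⟨w, g, e, -⟩ := h.exists_reachIn_grid hK rfl hN (P := 2 * N) (by omega)
      (stateOnGrid_start A)
    exact ⟨w, g, (regionClass_eq_iff.1 e).1 ▸ hs⟩
  · rintro ⟨s, h, hs⟩
    exact ⟨s, h.silentReach, hs⟩

end ENTA

/-! ### The decision procedure -/

/-- Configurations: the location and the list of the values of the clocks, the timer last, in
units of the grid. -/
abbrev Config := ℕ × List ℕ

/-- The comparison with code `k`. -/
def CodeHolds (k x y : ℕ) : Prop :=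
  (k = 0 ∧ x < y) ∨ (k = 1 ∧ x ≤ y) ∨ (k = 2 ∧ x = y) ∨ (k = 3 ∧ y ≤ x) ∨ (k = 4 ∧ y < x)

instance (k x y : ℕ) : Decidable (CodeHolds k x y) := by unfold CodeHolds; infer_instance

/-- The guard `g` holds for the clock values `l`, in units of `1 / M`. -/
def GuardHolds (M : ℕ) (g : List (ℕ × ℕ × ℕ)) (l : List ℕ) : Prop :=
  ∀ φ ∈ g, CodeHolds φ.2.1 (l.getD φ.1 0) (φ.2.2 * M)

instance (M : ℕ) (g : List (ℕ × ℕ × ℕ)) (l : List ℕ) : Decidable (GuardHolds M g l) := by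
  unfold GuardHolds; infer_instance

/-- The transition `τ` has the label `o` and is enabled. -/
def Enabled (M : ℕ) (o : Option ℕ) (τ : TransitionCode) (s : Config) : Prop :=
  τ.1 = s.1 ∧ τ.2.1 = o ∧ GuardHolds M τ.2.2.1 s.2

instance (M : ℕ) (o : Option ℕ) (τ : TransitionCode) (s : Config) :
    Decidable (Enabled M o τ s) := by
  unfold Enabled; infer_instance

/-- The configuration after the transition `τ` of an automaton with `r` clocks. -/
def jumpConfig (r : ℕ) (τ : TransitionCode) (s : Config) : Config :=
  (τ.2.2.2.2, (List.range (r + 1)).map fun i => if i ∈ τ.2.2.2.1 then 0 else s.2.getD i 0)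

/-- The configurations after one jump with label `o`. -/
def jumpConfigs (c : ENTACode) (M : ℕ) (o : Option ℕ) (s : Config) : List Config :=
  (c.2.2.2.filter fun τ => Enabled M o τ s).map fun τ => jumpConfig c.1.2.2 τ s

/-- The configurations after a delay of fewer than `D` units or a silent jump. -/
def moveConfigs (c : ENTACode) (M D : ℕ) (s : Config) : List Config :=
  (List.range D).map (fun d => (s.1, s.2.map (· + d))) ++ jumpConfigs c M none s

/-- The configurations after `N` moves. -/
def explore (c : ENTACode) (M D N : ℕ) (L : List Config) : List Config :=
  (fun L => L.flatMap (moveConfigs c M D))^[N] L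

/-- The timer value `x`, in units of `1 / M`, is in the given cell. -/
def CodeInCell (M k : ℕ) (b : Bool) (x : ℕ) : Prop :=
  (b = false ∧ x = k * M) ∨ (b = true ∧ k * M < x ∧ x < (k + 1) * M)

instance (M k : ℕ) (b : Bool) (x : ℕ) : Decidable (CodeInCell M k b x) := by
  unfold CodeInCell; infer_instance

/-- A location of `L` is accepting. -/
def AnyAccepting (c : ENTACode) (L : List Config) : Prop := ∃ s ∈ L, s.1 ∈ c.2.2.1

instance (c : ENTACode) (L : List Config) : Decidable (AnyAccepting c L) := by
  unfold AnyAccepting; infer_instance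

/-- The exploration finds the action `a` in the given cell. -/
def CodeObserved (c : ENTACode) (M D N : ℕ) (L : List Config) (a k : ℕ) (b : Bool) : Prop :=
  AnyAccepting c (explore c M D N
    ((L.filter fun s => CodeInCell M k b (s.2.getD c.1.2.2 0)).flatMap
      (jumpConfigs c M (some a))))

instance (c : ENTACode) (M D N : ℕ) (L : List Config) (a k : ℕ) (b : Bool) :
    Decidable (CodeObserved c M D N L a k b) := by
  unfold CodeObserved; infer_instance

/-- The exploration finds the empty trace and all actions in all cells before time `J`. -/
def CodeUniversal (c : ENTACode) (M D N J : ℕ) (L : List Config) : Prop :=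
  AnyAccepting c L ∧ ∀ k < J, ∀ a < c.1.2.1,
    CodeObserved c M D N L a k false ∧ CodeObserved c M D N L a k true

instance (c : ENTACode) (M D N J : ℕ) (L : List Config) :
    Decidable (CodeUniversal c M D N J L) := by
  unfold CodeUniversal; infer_instance

/-- An upper bound for the constants of the automaton. -/
def constantBound (c : ENTACode) : ℕ :=
  (c.2.2.2.flatMap fun τ => τ.2.2.1.map fun φ => φ.2.2).foldr (· + ·) 0

/-- The number of classes, for `n` locations, `r` clocks and a timer. -/
def classNumber (n r K : ℕ) : ℕ :=
  n * 2 ^ ((r + 1) * ((K + 1) * 2) + (r + 1) * ((r + 1) * ((K + 1) * 2)))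

/-- The times that have to be examined are those before `timeBound c`. -/
def timeBound (c : ENTACode) : ℕ := 2 ^ classNumber c.1.1 c.1.2.2 (constantBound c + 1)

/-- The constant of the regions that are used for these times. -/
def regionBound (c : ENTACode) : ℕ := constantBound c + timeBound c

/-- The number of moves of the exploration. -/
def moveBound (c : ENTACode) : ℕ := classNumber c.1.1 c.1.2.2 (regionBound c)

/-- The grid of the exploration. -/
def gridSize (c : ENTACode) : ℕ := 2 ^ (2 * moveBound c)

/-- The number of delays that are tried in each move. -/
def delayNumber (c : ENTACode) : ℕ := (regionBound c + 1) * gridSize c + 1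

/-- The configurations found from the initial one. -/
def initialExploration (c : ENTACode) : List Config :=
  explore c (gridSize c) (delayNumber c) (moveBound c)
    [(c.2.1, (List.range (c.1.2.2 + 1)).map fun _ => 0)]

/-- The decision procedure for `1`-bounded universality. -/
def decideUniversal (c : ENTACode) : Bool :=
  decide (CodeUniversal c (gridSize c) (delayNumber c) (moveBound c) (timeBound c)
    (initialExploration c))

/-! ### Its computability -/

section Computability

open Primrec

theorem primrecPred_codeHolds : PrimrecPred fun p : ℕ × ℕ × ℕ => CodeHolds p.1 p.2.1 p.2.2 := by
  have hx : Primrec fun p : ℕ × ℕ × ℕ => p.2.1 := fst.comp snd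
  have hy : Primrec fun p : ℕ × ℕ × ℕ => p.2.2 := snd.comp snd
  have hk : ∀ j : ℕ, PrimrecPred fun p : ℕ × ℕ × ℕ => p.1 = j := fun j =>
    Primrec.eq.comp fst (const j)
  exact ((hk 0).and (nat_lt.comp hx hy)).or <| ((hk 1).and (nat_le.comp hx hy)).or <|
    ((hk 2).and (Primrec.eq.comp hx hy)).or <| ((hk 3).and (nat_le.comp hy hx)).or <|
    (hk 4).and (nat_lt.comp hy hx)

theorem primrecRel_guardHolds :
    PrimrecRel fun (g : List (ℕ × ℕ × ℕ)) (p : ℕ × List ℕ) => GuardHolds p.1 g p.2 := by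
  refine PrimrecRel.forall_mem_list
    (R := fun (φ : ℕ × ℕ × ℕ) (p : ℕ × List ℕ) => CodeHolds φ.2.1 (p.2.getD φ.1 0) (φ.2.2 * p.1)) ?_
  refine PrimrecPred.primrecRel (p := fun q : (ℕ × ℕ × ℕ) × ℕ × List ℕ =>
    CodeHolds q.1.2.1 (q.2.2.getD q.1.1 0) (q.1.2.2 * q.2.1)) ?_
  exact primrecPred_codeHolds.comp <| (fst.comp (snd.comp fst)).pair <|
    ((list_getD 0).comp (snd.comp snd) (fst.comp fst)).pair <|
    nat_mul.comp (snd.comp (snd.comp fst)) (fst.comp snd)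

theorem primrecRel_enabled :
    PrimrecRel fun (τ : TransitionCode) (p : ℕ × Option ℕ × Config) =>
      Enabled p.1 p.2.1 τ p.2.2 := by
  refine PrimrecPred.primrecRel (p := fun q : TransitionCode × ℕ × Option ℕ × Config =>
    Enabled q.2.1 q.2.2.1 q.1 q.2.2.2) ?_
  have hs : Primrec fun q : TransitionCode × ℕ × Option ℕ × Config => q.2.2.2 :=
    snd.comp (snd.comp snd)
  have hl : Primrec fun q : TransitionCode × ℕ × Option ℕ × Config => q.1.2 := snd.comp fst
  exact (Primrec.eq.comp (fst.comp fst) (fst.comp hs)).and <|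
    (Primrec.eq.comp (fst.comp hl) (fst.comp (snd.comp snd))).and <|
    primrecRel_guardHolds.comp (fst.comp (snd.comp hl)) ((fst.comp snd).pair (snd.comp hs))

/-- A bounded quantifier is a quantifier over the list `List.range n`. -/
theorem primrecRel_forall_lt {β : Type*} [Primcodable β] {R : ℕ → β → Prop} (hR : PrimrecRel R) :
    PrimrecRel fun n y => ∀ x < n, R x y :=
  (hR.forall_mem_list.comp₂ (list_range.comp₂ Primrec₂.left) Primrec₂.right).of_eq fun n y => by
    simp

theorem primrecRel_mem {α : Type*} [Primcodable α] :
    PrimrecRel fun (a : α) (L : List α) => a ∈ L :=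
  (PrimrecRel.exists_mem_list (R := fun b a : α => b = a) Primrec.eq).swap.of_eq fun a L => by
    simp [Function.swap]

variable {α : Type*} [Primcodable α] {c : α → ENTACode} {M D N : α → ℕ} {L : α → List Config}

theorem primrec_jumpConfig {r : α → ℕ} {τ : α → TransitionCode} {s : α → Config}
    (hr : Primrec r) (hτ : Primrec τ) (hs : Primrec s) :
    Primrec fun x => jumpConfig (r x) (τ x) (s x) := by
  have h1 : Primrec fun x => (τ x).2.2.2 := snd.comp (snd.comp (snd.comp hτ))
  refine (snd.comp h1).pair (list_map (list_range.comp (succ.comp hr)) ?_)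
  exact Primrec.ite (primrecRel_mem.comp snd ((fst.comp h1).comp fst)) (const 0)
    ((list_getD 0).comp ((snd.comp hs).comp fst) snd)

theorem primrec_jumpConfigs {o : α → Option ℕ} {s : α → Config} (hc : Primrec c)
    (hM : Primrec M) (ho : Primrec o) (hs : Primrec s) :
    Primrec fun x => jumpConfigs (c x) (M x) (o x) (s x) := by
  refine list_map (f := fun x => (c x).2.2.2.filter fun τ => Enabled (M x) (o x) τ (s x))
    ((PrimrecRel.listFilter primrecRel_enabled).comp
      (g := fun x => (c x).2.2.2) (h := fun x => (M x, o x, s x))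
      (snd.comp (snd.comp (snd.comp hc))) (hM.pair (ho.pair hs))) ?_
  exact primrec_jumpConfig ((snd.comp (snd.comp (fst.comp hc))).comp fst) snd (hs.comp fst)

theorem primrec_moveConfigs {s : α → Config} (hc : Primrec c) (hM : Primrec M) (hD : Primrec D)
    (hs : Primrec s) : Primrec fun x => moveConfigs (c x) (M x) (D x) (s x) := by
  refine list_append.comp (list_map (list_range.comp hD) ?_)
    (primrec_jumpConfigs hc hM (const none) hs)
  refine Primrec.pair ((fst.comp hs).comp fst) (list_map ((snd.comp hs).comp fst) ?_)
  exact nat_add.comp snd (snd.comp fst)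

theorem primrec_explore (hc : Primrec c) (hM : Primrec M) (hD : Primrec D) (hN : Primrec N)
    (hL : Primrec L) : Primrec fun x => explore (c x) (M x) (D x) (N x) (L x) := by
  refine nat_iterate hN hL (h := fun x L => L.flatMap (moveConfigs (c x) (M x) (D x))) ?_
  refine list_flatMap snd ?_
  have h : Primrec fun p : (α × List Config) × Config => p.1.1 := fst.comp fst
  exact primrec_moveConfigs (hc.comp h) (hM.comp h) (hD.comp h) snd

theorem primrecRel_codeInCell :
    PrimrecRel fun (s : Config) (p : ℕ × ℕ × ℕ × Bool) =>
      CodeInCell p.1 p.2.2.1 p.2.2.2 (s.2.getD p.2.1 0) := by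
  refine PrimrecPred.primrecRel (p := fun q : Config × ℕ × ℕ × ℕ × Bool =>
    CodeInCell q.2.1 q.2.2.2.1 q.2.2.2.2 (q.1.2.getD q.2.2.1 0)) ?_
  have hM : Primrec fun q : Config × ℕ × ℕ × ℕ × Bool => q.2.1 := fst.comp snd
  have hp : Primrec fun q : Config × ℕ × ℕ × ℕ × Bool => q.2.2.2 := snd.comp (snd.comp snd)
  have hx : Primrec fun q : Config × ℕ × ℕ × ℕ × Bool => q.1.2.getD q.2.2.1 0 :=
    (list_getD 0).comp (snd.comp fst) (fst.comp (snd.comp snd))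
  exact ((Primrec.eq.comp (snd.comp hp) (const false)).and
    (Primrec.eq.comp hx (nat_mul.comp (fst.comp hp) hM))).or <|
    (Primrec.eq.comp (snd.comp hp) (const true)).and <|
    (nat_lt.comp (nat_mul.comp (fst.comp hp) hM) hx).and
    (nat_lt.comp hx (nat_mul.comp (succ.comp (fst.comp hp)) hM))

theorem primrecPred_anyAccepting (hc : Primrec c) (hL : Primrec L) :
    PrimrecPred fun x => AnyAccepting (c x) (L x) := by
  refine (PrimrecRel.exists_mem_list (R := fun (s : Config) (F : List ℕ) => s.1 ∈ F) ?_).comp hL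
    (fst.comp (snd.comp (snd.comp hc)))
  exact PrimrecPred.primrecRel (p := fun q : Config × List ℕ => q.1.1 ∈ q.2)
    (primrecRel_mem.comp (fst.comp fst) snd)

theorem primrecPred_codeObserved {a k : α → ℕ} {b : α → Bool} (hc : Primrec c) (hM : Primrec M)
    (hD : Primrec D) (hN : Primrec N) (hL : Primrec L) (ha : Primrec a) (hk : Primrec k)
    (hb : Primrec b) :
    PrimrecPred fun x => CodeObserved (c x) (M x) (D x) (N x) (L x) (a x) (k x) (b x) := by
  have hr : Primrec fun x => (c x).1.2.2 := snd.comp (snd.comp (fst.comp hc))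
  refine primrecPred_anyAccepting hc (primrec_explore hc hM hD hN (list_flatMap
    ((PrimrecRel.listFilter primrecRel_codeInCell).comp (g := L)
      (h := fun x => (M x, (c x).1.2.2, k x, b x)) hL (hM.pair (hr.pair (hk.pair hb)))) ?_))
  exact primrec_jumpConfigs (hc.comp fst) (hM.comp fst) (option_some.comp (ha.comp fst)) snd

theorem primrecPred_codeUniversal {J : α → ℕ} (hc : Primrec c) (hM : Primrec M)
    (hD : Primrec D) (hN : Primrec N) (hJ : Primrec J) (hL : Primrec L) :
    PrimrecPred fun x => CodeUniversal (c x) (M x) (D x) (N x) (J x) (L x) := by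
  refine (primrecPred_anyAccepting hc hL).and ?_
  refine (primrecRel_forall_lt (R := fun (k : ℕ) (x : α) => ∀ a < (c x).1.2.1,
    CodeObserved (c x) (M x) (D x) (N x) (L x) a k false ∧
      CodeObserved (c x) (M x) (D x) (N x) (L x) a k true) ?_).comp hJ .id
  refine (primrecRel_forall_lt (R := fun (a : ℕ) (y : ℕ × α) =>
    CodeObserved (c y.2) (M y.2) (D y.2) (N y.2) (L y.2) a y.1 false ∧
      CodeObserved (c y.2) (M y.2) (D y.2) (N y.2) (L y.2) a y.1 true) ?_).comp
    ((fst.comp (snd.comp (fst.comp hc))).comp snd) .id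
  have h : Primrec fun p : ℕ × ℕ × α => p.2.2 := snd.comp snd
  have hb : ∀ b, PrimrecPred fun p : ℕ × ℕ × α => CodeObserved (c p.2.2) (M p.2.2) (D p.2.2)
      (N p.2.2) (L p.2.2) p.1 p.2.1 b := fun b =>
    primrecPred_codeObserved (hc.comp h) (hM.comp h) (hD.comp h) (hN.comp h) (hL.comp h) fst
      (fst.comp snd) (const b)
  exact PrimrecPred.primrecRel (p := fun p : ℕ × ℕ × α =>
    CodeObserved (c p.2.2) (M p.2.2) (D p.2.2) (N p.2.2) (L p.2.2) p.1 p.2.1 false ∧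
      CodeObserved (c p.2.2) (M p.2.2) (D p.2.2) (N p.2.2) (L p.2.2) p.1 p.2.1 true)
    ((hb false).and (hb true))

theorem primrec_two_pow {f : α → ℕ} (hf : Primrec f) : Primrec fun x => 2 ^ f x :=
  (Primrec₂.unpaired'.1 Nat.Primrec.pow).comp (const 2) hf

theorem primrec_constantBound : Primrec constantBound := by
  refine list_foldr (h := fun (_ : ENTACode) (p : ℕ × ℕ) => p.1 + p.2) (list_flatMap
    (snd.comp (snd.comp snd)) (list_map (fst.comp (snd.comp (snd.comp snd))) ?_)) (const 0)
    (nat_add.comp (fst.comp snd) (snd.comp snd))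
  exact snd.comp (snd.comp snd)

theorem primrec_classNumber {n r K : α → ℕ} (hn : Primrec n) (hr : Primrec r) (hK : Primrec K) :
    Primrec fun x => classNumber (n x) (r x) (K x) := by
  have hr1 : Primrec fun x => r x + 1 := succ.comp hr
  have hK2 : Primrec fun x => (K x + 1) * 2 := nat_mul.comp (succ.comp hK) (const 2)
  exact nat_mul.comp hn <| primrec_two_pow <| nat_add.comp (nat_mul.comp hr1 hK2)
    (nat_mul.comp hr1 (nat_mul.comp hr1 hK2))

theorem primrec_decideUniversal : Primrec decideUniversal := by
  have hn : Primrec fun c : ENTACode => c.1.1 := fst.comp fst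
  have hr : Primrec fun c : ENTACode => c.1.2.2 := snd.comp (snd.comp fst)
  have hJ : Primrec timeBound :=
    primrec_two_pow (primrec_classNumber hn hr (succ.comp primrec_constantBound))
  have hK : Primrec regionBound := nat_add.comp primrec_constantBound hJ
  have hN : Primrec moveBound := primrec_classNumber hn hr hK
  have hM : Primrec gridSize := primrec_two_pow (nat_mul.comp (const 2) hN)
  have hD : Primrec delayNumber := succ.comp (nat_mul.comp (succ.comp hK) hM)
  have hL : Primrec initialExploration := primrec_explore .id hM hD hN <|
    list_cons.comp ((fst.comp snd).pair (list_map (list_range.comp (succ.comp hr)) (const 0).to₂))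
      (const [])
  exact (primrecPred_codeUniversal .id hM hD hN hJ hL).decide

end Computability

/-! ### Its correctness -/

section Correctness

open ENTA

variable {Q Act C : Type} {n m r : ℕ} {eQ : Q ≃ Fin n} {eA : Act ≃ Fin m} {eC : C ≃ Fin r}
  {A : ENTA Q Act C}

theorem natCard_regionClass (eQ : Q ≃ Fin n) (eC : C ≃ Fin r) (K : ℕ) :
    Nat.card (Q × Set (RegionAtom (Option C) K)) = classNumber n r K := by
  have : Finite C := Finite.of_equiv _ eC.symm
  have hQ : Nat.card Q = n := by rw [Nat.card_congr eQ, Nat.card_fin]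
  have hC : Nat.card (Option C) = r + 1 := by
    rw [Finite.card_option, Nat.card_congr eC, Nat.card_fin]
  have hB : Nat.card Bool = 2 := by simp
  rw [Nat.card_prod, natCard_set, Nat.card_sum]
  simp only [Nat.card_prod, hQ, hC, hB, Nat.card_fin, classNumber]

theorem boundedBy_constantBound : A.BoundedBy (constantBound (A.code eQ eA eC)) := by
  intro τ hτ φ hφ
  rw [constantBound, ← List.sum_eq_foldr]
  refine List.single_le_sum (fun _ _ => Nat.zero_le _) _ ?_
  simp only [ENTA.code, List.mem_flatMap, List.mem_map]
  refine ⟨_, ⟨τ, hτ, rfl⟩, ?_⟩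
  simp only [Transition.code, List.mem_map]
  exact ⟨_, ⟨φ, hφ, rfl⟩, rfl⟩

/-! ### Integer configurations presenting states -/

/-- The position of a clock in configurations. -/
def clockIndex (eC : C ≃ Fin r) (x : Option C) : ℕ := x.elim r fun c => eC c

theorem clockIndex_lt (eC : C ≃ Fin r) (x : Option C) : clockIndex eC x < r + 1 := by
  cases x with
  | none => exact Nat.lt_succ_self r
  | some c => exact (eC c).2.trans (Nat.lt_succ_self r)

/-- The configuration `cfg` presents the state `s`, in units of `1 / M`. -/
structure Presents (eQ : Q ≃ Fin n) (eC : C ≃ Fin r) (M : ℕ) (cfg : Config)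
    (s : State Q (Option C)) : Prop where
  location : cfg.1 = eQ s.1
  length : cfg.2.length = r + 1
  clock : ∀ x, ((cfg.2.getD (clockIndex eC x) 0 : ℕ) : ℝ≥0) = s.2 x * M

theorem codeHolds_iff {M u : ℕ} (hM : 0 < M) {x : ℝ≥0} (hu : (u : ℝ≥0) = x * M) (k : Cmp)
    (b : ℕ) : CodeHolds k.code u (b * M) ↔ k.Holds x b := by
  have hM' : (0 : ℝ≥0) < M := by exact_mod_cast hM
  have h1 : u < b * M ↔ x < b := by
    rw [← Nat.cast_lt (α := ℝ≥0), hu, Nat.cast_mul, mul_lt_mul_iff_left₀ hM']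
  have h2 : b * M < u ↔ (b : ℝ≥0) < x := by
    rw [← Nat.cast_lt (α := ℝ≥0), hu, Nat.cast_mul, mul_lt_mul_iff_left₀ hM']
  cases k <;> simp only [CodeHolds, Cmp.code, Cmp.Holds, ge_iff_le, gt_iff_lt, ← not_lt, h1, h2,
    OfNat.ofNat_ne_zero, OfNat.ofNat_ne_one, OfNat.zero_ne_ofNat,
    OfNat.one_ne_ofNat, zero_ne_one, one_ne_zero, Nat.reduceEqDiff, false_and, true_and, false_or,
    or_false]
  rw [eq_iff_le_not_lt, ← not_lt, h1, h2, eq_iff_le_not_lt, ← not_lt]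

theorem codeInCell_iff {M u : ℕ} (hM : 0 < M) {x : ℝ≥0} (hu : (u : ℝ≥0) = x * M) (k : ℕ)
    (b : Bool) : CodeInCell M k b u ↔ InCell k b x := by
  have h := fun (j : Cmp) (b : ℕ) => codeHolds_iff hM hu j b
  cases b
  · have := h .eq k
    simpa [CodeHolds, Cmp.code, Cmp.Holds, CodeInCell, InCell] using this
  · have h1 := h .gt k
    have h2 := h .lt (k + 1)
    simp only [CodeHolds, Cmp.code, Cmp.Holds] at h1 h2
    simp only [CodeInCell, InCell]
    simp only [gt_iff_lt, Nat.cast_add, Nat.cast_one] at h1 h2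
    rw [← h1, ← h2]
    simp

namespace Presents

variable {M : ℕ} {cfg : Config} {s : State Q (Option C)}

theorem guardHolds_iff (hM : 0 < M) (h : Presents eQ eC M cfg s) (τ : Transition Q Act C) :
    GuardHolds M (τ.code eQ eA eC).2.2.1 cfg.2 ↔
      ClockValuation.Satisfies (fun c => s.2 (some c)) τ.guard := by
  simp only [GuardHolds, ClockValuation.Satisfies, Transition.code, List.forall_mem_map]
  exact forall₂_congr fun φ _ => codeHolds_iff hM (h.clock (some φ.clock)) φ.cmp φ.bound

theorem delay (h : Presents eQ eC M cfg s) {d : ℕ} {e : ℝ≥0} (hd : (d : ℝ≥0) = e * M) :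
    Presents eQ eC M (cfg.1, cfg.2.map (· + d)) (s.1, s.2.delay e) where
  location := h.location
  length := by simp [h.length]
  clock x := by
    have hx : clockIndex eC x < cfg.2.length := h.length ▸ clockIndex_lt eC x
    have := h.clock x
    rw [List.getD_eq_getElem _ _ hx] at this
    rw [List.getD_eq_getElem _ _ (by simpa using hx)]
    simp [ClockValuation.delay, add_mul, this, hd]

theorem jump (h : Presents eQ eC M cfg s) (τ : Transition Q Act C) :
    Presents eQ eC M (jumpConfig r (τ.code eQ eA eC) cfg)
      (τ.target, s.2.reset (τ.resets.map some)) where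
  location := rfl
  length := by simp [jumpConfig]
  clock x := by
    have hx := clockIndex_lt eC x
    -- The timer sits at index `r`, beyond the indices of all clocks of the automaton, so no coded
    -- reset touches it.
    have hmem : clockIndex eC x ∈ (τ.code eQ eA eC).2.2.2.1 ↔ x ∈ τ.resets.map some := by
      simp only [Transition.code, List.mem_map]
      refine exists_congr fun c => and_congr_right fun _ => ?_
      cases x with
      | none => simpa [clockIndex] using (eC c).2.ne
      | some c' => simp [clockIndex, Fin.val_inj]
    rw [jumpConfig, List.getD_eq_getElem _ _ (by simpa using hx), List.getElem_map,
      List.getElem_range]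
    simp only [ClockValuation.reset]
    by_cases hxR : x ∈ τ.resets.map some
    · rw [if_pos hxR, if_pos (hmem.2 hxR)]; simp
    · rw [if_neg hxR, if_neg fun hi => hxR (hmem.1 hi)]; exact h.clock x

theorem mem_jumpConfigs_iff (hM : 0 < M) (h : Presents eQ eC M cfg s) (o : Option Act)
    (cfg' : Config) :
    cfg' ∈ jumpConfigs (A.code eQ eA eC) M (o.map fun a => (eA a : ℕ)) cfg ↔
      ∃ τ ∈ A.transitions, τ.label = o ∧ τ.source = s.1 ∧
        ClockValuation.Satisfies (fun c => s.2 (some c)) τ.guard ∧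
        cfg' = jumpConfig r (τ.code eQ eA eC) cfg := by
  have hcode : (A.code eQ eA eC).2.2.2 = A.transitions.map (Transition.code eQ eA eC) := rfl
  have hr : (A.code eQ eA eC).1.2.2 = r := rfl
  have hinj : Function.Injective fun a => (eA a : ℕ) := Fin.val_injective.comp eA.injective
  rw [jumpConfigs, hcode, hr]
  simp only [List.mem_map, List.mem_filter, decide_eq_true_eq]
  constructor
  · rintro ⟨_, ⟨⟨τ, hτ, rfl⟩, h1, h2, h3⟩, rfl⟩
    refine ⟨τ, hτ, Option.map_injective hinj h2, ?_, (h.guardHolds_iff hM τ).1 h3, rfl⟩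
    rw [h.location] at h1
    exact eQ.injective (Fin.val_injective h1)
  · rintro ⟨τ, hτ, rfl, h1, h2, rfl⟩
    refine ⟨_, ⟨⟨τ, hτ, rfl⟩, ?_, rfl, (h.guardHolds_iff hM τ).2 h2⟩, rfl⟩
    rw [h.location, ← h1]
    rfl

theorem exists_of_timerJump (hM : 0 < M) (h : Presents eQ eC M cfg s) {τ : Transition Q Act C}
    (hτ : τ ∈ A.transitions) {s' : State Q (Option C)} (hj : TimerJump τ s s') :
    ∃ cfg' ∈ jumpConfigs (A.code eQ eA eC) M (τ.label.map fun a => (eA a : ℕ)) cfg,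
      Presents eQ eC M cfg' s' := by
  obtain ⟨h1, h2, rfl⟩ := hj
  exact ⟨_, (h.mem_jumpConfigs_iff hM _ _).2 ⟨τ, hτ, rfl, h1, h2, rfl⟩, h.jump τ⟩

theorem exists_timerJump (hM : 0 < M) (h : Presents eQ eC M cfg s) {o : Option Act}
    {cfg' : Config}
    (hc : cfg' ∈ jumpConfigs (A.code eQ eA eC) M (o.map fun a => (eA a : ℕ)) cfg) :
    ∃ τ ∈ A.transitions, ∃ s', τ.label = o ∧ TimerJump τ s s' ∧ Presents eQ eC M cfg' s' := by
  obtain ⟨τ, hτ, h1, h2, h3, rfl⟩ := (h.mem_jumpConfigs_iff hM o cfg').1 hc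
  exact ⟨τ, hτ, _, h1, ⟨h2, h3, rfl⟩, h.jump τ⟩

variable {K P : ℕ}

theorem exists_of_silentMove (h : Presents eQ eC (2 ^ P) cfg s) {s' : State Q (Option C)}
    (hm : A.SilentMove (GridDelay K P) s s') :
    ∃ cfg' ∈ moveConfigs (A.code eQ eA eC) (2 ^ P) ((K + 1) * 2 ^ P + 1) cfg,
      Presents eQ eC (2 ^ P) cfg' s' := by
  rcases hm with ⟨e, ⟨he, d, hd⟩, rfl⟩ | ⟨τ, hτ, hl, hj⟩
  · refine ⟨_, List.mem_append_left _ (List.mem_map.2 ⟨d, ?_, rfl⟩),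
      h.delay (by push_cast; exact hd.symm)⟩
    -- The extra `1` in the number of delays admits the maximal delay `K + 1` itself.
    rw [List.mem_range, Nat.lt_succ_iff, ← Nat.cast_le (α := ℝ≥0), ← hd]
    push_cast
    gcongr
  · obtain ⟨cfg', h1, h2⟩ := h.exists_of_timerJump (eA := eA) (by positivity) hτ hj
    rw [hl] at h1
    exact ⟨cfg', List.mem_append_right _ h1, h2⟩

theorem exists_silentMove (h : Presents eQ eC (2 ^ P) cfg s) {cfg' : Config}
    (hc : cfg' ∈ moveConfigs (A.code eQ eA eC) (2 ^ P) ((K + 1) * 2 ^ P + 1) cfg) :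
    ∃ s', A.SilentMove (GridDelay K P) s s' ∧ Presents eQ eC (2 ^ P) cfg' s' := by
  rcases List.mem_append.1 hc with hc | hc
  · obtain ⟨d, hd, rfl⟩ := List.mem_map.1 hc
    have hpos : (2 : ℝ≥0) ^ P ≠ 0 := by positivity
    have hdiv : (d : ℝ≥0) / 2 ^ P * 2 ^ P = d := div_mul_cancel₀ _ hpos
    refine ⟨_, .inl ⟨(d : ℝ≥0) / 2 ^ P, ⟨?_, d, hdiv⟩, rfl⟩,
      h.delay (by push_cast; exact hdiv.symm)⟩
    rw [List.mem_range, Nat.lt_succ_iff, ← Nat.cast_le (α := ℝ≥0)] at hd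
    rw [div_le_iff₀ (by positivity)]
    push_cast at hd
    exact hd
  · obtain ⟨τ, hτ, s', h1, h2, h3⟩ := h.exists_timerJump (o := none) (by positivity) hc
    exact ⟨s', .inr ⟨τ, hτ, h1, h2⟩, h3⟩

theorem exists_of_reachIn {N : ℕ} {L : List Config} (hL : cfg ∈ L)
    (h : Presents eQ eC (2 ^ P) cfg s) {s' : State Q (Option C)}
    (hs : ReachIn (A.SilentMove (GridDelay K P)) N s s') :
    ∃ cfg' ∈ explore (A.code eQ eA eC) (2 ^ P) ((K + 1) * 2 ^ P + 1) N L,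
      Presents eQ eC (2 ^ P) cfg' s' := by
  induction N generalizing s' with
  | zero => cases hs; exact ⟨cfg, hL, h⟩
  | succ N ih =>
    obtain ⟨s₁, h1, h2⟩ := hs
    obtain ⟨cfg₁, h3, h4⟩ := ih h1
    obtain ⟨cfg₂, h5, h6⟩ := h4.exists_of_silentMove h2
    refine ⟨cfg₂, ?_, h6⟩
    rw [explore, Function.iterate_succ_apply']
    exact List.mem_flatMap.2 ⟨cfg₁, h3, h5⟩

end Presents

/-- The search after the emission starts from many configurations, so the origin `cfg` of the path
is traced back first, and only then is a state presented by it supplied. -/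
theorem exists_reachIn_of_mem_explore {K P N : ℕ} {L : List Config} {cfg' : Config}
    (hc : cfg' ∈ explore (A.code eQ eA eC) (2 ^ P) ((K + 1) * 2 ^ P + 1) N L) :
    ∃ cfg ∈ L, ∀ s : State Q (Option C), Presents eQ eC (2 ^ P) cfg s → ∃ s',
      ReachIn (A.SilentMove (GridDelay K P)) N s s' ∧ Presents eQ eC (2 ^ P) cfg' s' := by
  induction N generalizing cfg' with
  | zero => exact ⟨cfg', hc, fun s hs => ⟨s, rfl, hs⟩⟩
  | succ N ih =>
    rw [explore, Function.iterate_succ_apply'] at hc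
    obtain ⟨cfg₁, h1, h2⟩ := List.mem_flatMap.1 hc
    obtain ⟨cfg, h3, h4⟩ := ih h1
    refine ⟨cfg, h3, fun s hs => ?_⟩
    obtain ⟨s₁, h5, h6⟩ := h4 s hs
    obtain ⟨s₂, h7, h8⟩ := h6.exists_silentMove h2
    exact ⟨s₂, ⟨s₁, h5, h7⟩, h8⟩

theorem Presents.accepting_iff {M : ℕ} {cfg : Config} {s : State Q (Option C)}
    (h : Presents eQ eC M cfg s) :
    cfg.1 ∈ (A.code eQ eA eC).2.2.1 ↔ s.1 ∈ A.accepting := by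
  rw [h.location]
  exact List.mem_map_of_injective (Fin.val_injective.comp eQ.injective)

theorem presents_start (eQ : Q ≃ Fin n) (eA : Act ≃ Fin m) (eC : C ≃ Fin r) (A : ENTA Q Act C)
    (M : ℕ) :
    Presents eQ eC M ((A.code eQ eA eC).2.1,
      (List.range ((A.code eQ eA eC).1.2.2 + 1)).map fun _ => 0) (A.start 0) where
  location := rfl
  length := by simp [ENTA.code]
  clock x := by
    have h0 : (A.start 0).2 x = 0 := by cases x <;> rfl
    rw [h0, List.getD_eq_getElem _ _ (by simpa [ENTA.code] using clockIndex_lt eC x)]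
    simp

theorem anyAccepting_initialExploration_iff :
    AnyAccepting (A.code eQ eA eC) (initialExploration (A.code eQ eA eC)) ↔
      [] ∈ A.language := by
  have : Finite Q := Finite.of_equiv _ eQ.symm
  have : Finite C := Finite.of_equiv _ eC.symm
  set c := A.code eQ eA eC with hc
  have hK : A.BoundedBy (regionBound c) :=
    (boundedBy_constantBound (eQ := eQ) (eA := eA) (eC := eC)).mono (Nat.le_add_right _ _)
  rw [nil_mem_language_iff_grid hK (N := moveBound c) (natCard_regionClass eQ eC _).symm]
  constructor
  · rintro ⟨cfg', h1, h2⟩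
    obtain ⟨cfg, h3, h4⟩ := exists_reachIn_of_mem_explore h1
    rw [List.mem_singleton] at h3
    subst h3
    obtain ⟨s, h5, h6⟩ := h4 _ (presents_start eQ eA eC A _)
    exact ⟨s, h5, h6.accepting_iff.1 h2⟩
  · rintro ⟨s, h1, h2⟩
    obtain ⟨cfg, h3, h4⟩ := (presents_start eQ eA eC A _).exists_of_reachIn (eA := eA)
      (List.mem_singleton_self _) h1
    exact ⟨cfg, h3, h4.accepting_iff.2 h2⟩

theorem codeObserved_iff {k : ℕ} (hk : k < timeBound (A.code eQ eA eC)) (a : Act) (b : Bool) :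
    CodeObserved (A.code eQ eA eC) (gridSize (A.code eQ eA eC)) (delayNumber (A.code eQ eA eC))
      (moveBound (A.code eQ eA eC)) (initialExploration (A.code eQ eA eC)) (eA a) k b ↔
      A.CellObserved a k b := by
  have : Finite Q := Finite.of_equiv _ eQ.symm
  have : Finite C := Finite.of_equiv _ eC.symm
  set c := A.code eQ eA eC with hc
  have hK : A.BoundedBy (regionBound c) :=
    (boundedBy_constantBound (eQ := eQ) (eA := eA) (eC := eC)).mono (Nat.le_add_right _ _)
  have hkK : k + 1 ≤ regionBound c := le_add_left hk
  have hM : 0 < gridSize c := by unfold gridSize; positivity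
  have hr : c.1.2.2 = clockIndex eC none := rfl
  rw [cellObserved_iff_grid hK hkK a b (N := moveBound c) (natCard_regionClass eQ eC _).symm]
  constructor
  · rintro ⟨cfg₃, h1, h2⟩
    obtain ⟨cfg₂, h3, h4⟩ := exists_reachIn_of_mem_explore h1
    obtain ⟨cfg₁, h5, h6⟩ := List.mem_flatMap.1 h3
    rw [List.mem_filter, decide_eq_true_eq] at h5
    obtain ⟨cfg₀, h7, h8⟩ := exists_reachIn_of_mem_explore h5.1
    rw [List.mem_singleton] at h7
    subst h7
    obtain ⟨s₁, g1, g2⟩ := h8 _ (presents_start eQ eA eC A _)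
    obtain ⟨τ, hτ, s₂, g3, g4, g5⟩ := g2.exists_timerJump (o := some a) hM h6
    obtain ⟨s₃, g6, g7⟩ := h4 s₂ g5
    refine ⟨s₁, s₂, s₃, τ, g1, ?_, hτ, g3, g4, g6, g7.accepting_iff.1 h2⟩
    exact (codeInCell_iff hM (g2.clock none) k b).1 h5.2
  · rintro ⟨s₁, s₂, s₃, τ, h1, h2, h3, h4, h5, h6, h7⟩
    obtain ⟨cfg₁, g1, g2⟩ := (presents_start eQ eA eC A _).exists_of_reachIn (eA := eA)
      (List.mem_singleton_self _) h1
    obtain ⟨cfg₂, g3, g4⟩ := g2.exists_of_timerJump (eA := eA) hM h3 h5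
    rw [h4] at g3
    have hmem : cfg₂ ∈ ((initialExploration c).filter fun s =>
        CodeInCell (gridSize c) k b (s.2.getD c.1.2.2 0)).flatMap
        (jumpConfigs c (gridSize c) (some (eA a : ℕ))) := by
      refine List.mem_flatMap.2 ⟨cfg₁, List.mem_filter.2 ⟨g1, decide_eq_true ?_⟩, g3⟩
      exact (codeInCell_iff hM (g2.clock none) k b).2 h2
    obtain ⟨cfg₃, g5, g6⟩ := g4.exists_of_reachIn (eA := eA) hmem h6
    exact ⟨cfg₃, g5, g6.accepting_iff.2 h7⟩

theorem decideUniversal_eq_true_iff :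
    decideUniversal (A.code eQ eA eC) = true ↔ A.BoundedUniversal 1 := by
  have : Finite Q := Finite.of_equiv _ eQ.symm
  have : Finite C := Finite.of_equiv _ eC.symm
  rw [decideUniversal, decide_eq_true_eq, CodeUniversal, anyAccepting_initialExploration_iff,
    boundedUniversal_one_iff]
  refine and_congr_right fun _ => ⟨fun h => ?_, fun h k hk a ha => ?_⟩
  -- Periodicity is applied with the small constant, which defines `timeBound`; `codeObserved_iff`
  -- works with the larger `regionBound`. Cells have a meaning independent of the constant, so the
  -- two fit together.
  · refine cellObserved_forall_of_lt (K := constantBound (A.code eQ eA eC) + 1)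
      (boundedBy_constantBound.mono (Nat.le_succ _)) (Nat.le_add_left _ _) fun k hk a b => ?_
    rw [natCard_regionClass eQ eC] at hk
    have := h k hk (eA a) (eA a).2
    rw [codeObserved_iff hk, codeObserved_iff hk] at this
    cases b
    · exact this.1
    · exact this.2
  · obtain ⟨a, rfl⟩ : ∃ a', (eA a' : ℕ) = a := ⟨eA.symm ⟨a, ha⟩, by simp⟩
    rw [codeObserved_iff hk, codeObserved_iff hk]
    exact ⟨h _ _ _, h _ _ _⟩

end Correctness

/-- One computable function, given the code of any automaton under any numbering of its finitely
many locations, actions and clocks, decides whether the automaton is `1`-bounded universal. -/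
theorem mainTheorem6 :
    ∃ decider : ENTACode → Bool, Computable decider ∧
      ∀ (Q Act C : Type) (n m r : ℕ) (eQ : Q ≃ Fin n) (eA : Act ≃ Fin m) (eC : C ≃ Fin r)
        (A : ENTA Q Act C),
        decider (A.code eQ eA eC) = true ↔ A.BoundedUniversal 1 :=
  ⟨decideUniversal, primrec_decideUniversal.to_comp,
    fun _ _ _ _ _ _ _ _ _ _ => decideUniversal_eq_true_iff⟩
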